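/- Let $J$ be a smooth manifold (Hausdorff, second countable, without boundary, not necessarily compact or connected) of real dimension $k$, and let $\iota_J\colon J\to J$ be a smooth involution whose fixed points are isolated. Fix a regularity class $n\in\{0,1,2,\dots,\infty\}$; all bundles and bundle maps below are of class $C^n$ (so $n=0$ is the topological category and $n=\infty$ the smooth one). A *quaternionic bundle* over $(J,\iota_J)$ is a complex vector bundle $E\to J$ together with a map $\iota_E\colon E\to E$ covering $\iota_J$ that is complex antilinear on each fibre and satisfies $\iota_E\circ\iota_E=-1$; its rank is its rank as a complex bundle. An isomorphism of quaternionic bundles is an isomorphism of complex vector bundles over $\mathrm{id}_J$ that commutes with these maps. The direct sum $E_1\oplus E_2$ carries $\iota_{E_1}\oplus\iota_{E_2}$. The trivial quaternionic bundle $\underline{\mathbb H}$ of rank $2$ is $J\times\mathbb H$, with $\mathbb H=\mathbb C\oplus \mathbf j\,\mathbb C$ a complex vector space by right multiplication, and with the antilinear lift $(x,q)\mapsto(\iota_J x,\,q\,\mathbf j)$. Let $E$ be a quaternionic bundle over $J$ of complex rank $2l$. If $4l\ge k+3$, then there is a quaternionic bundle $E'$ over $J$ (of complex rank $2l-2$)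 such that $E\cong\underline{\mathbb H}\oplus E'$ as quaternionic bundles. -/

import Mathlib

open Bundle Manifold
open scoped Manifold ContDiff Bundle Quaternion ComplexConjugate

/-! ### Complex vector bundles over real manifolds -/

section RealUnderlying

variable {B : Type*} [TopologicalSpace B] {F : Type*} [NormedAddCommGroup F] [NormedSpace ℂ F]
  {E : B → Type*} [∀ x, AddCommGroup (E x)] [∀ x, Module ℂ (E x)]
  [TopologicalSpace (TotalSpace F E)]

theorem isLinear_real_of_complex (e : Trivialization F (π F E)) [he : e.IsLinear ℂ] :
    e.IsLinear ℝ where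
  linear b hb :=
    { map_add := (he.linear b hb).map_add
      map_smul := fun c v => (he.linear b hb).map_smul (c : ℂ) v }

/-- The real vector bundle underlying a complex vector bundle: the same fibers and the same
trivializations, with scalars restricted to `ℝ`. -/
instance (priority := 50) VectorBundle.complexToReal [∀ x, TopologicalSpace (E x)]
    [FiberBundle F E] [VectorBundle ℂ F E] :
    VectorBundle ℝ F E where
  trivialization_linear' e _ := isLinear_real_of_complex e
  continuousOn_coordChange' e e' _ _ := by
    have := isLinear_real_of_complex e
    have := isLinear_real_of_complex e'
    refine ((ContinuousLinearMap.restrictScalarsIsometry ℂ F F ℝ ℝ).continuous.comp_continuousOn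
      (continuousOn_coordChange ℂ e e')).congr fun b hb => ?_
    ext v
    change e.coordChangeL ℝ e' b v = e.coordChangeL ℂ e' b v
    rw [e.coordChangeL_apply e' hb, e.coordChangeL_apply e' hb]

end RealUnderlying

/-! ### Regularity of maps into a fiberwise product -/

section ProdRegularity

variable {n : WithTop ℕ∞} {B F₁ F₂ M : Type*} {E₁ E₂ : B → Type*}
  {EB HB EM HM : Type*} [NormedAddCommGroup EB] [NormedSpace ℝ EB] [TopologicalSpace HB]
  {IB : ModelWithCorners ℝ EB HB} [TopologicalSpace B] [ChartedSpace HB B]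
  [NormedAddCommGroup EM] [NormedSpace ℝ EM] [TopologicalSpace HM]
  {IM : ModelWithCorners ℝ EM HM} [TopologicalSpace M] [ChartedSpace HM M]
  [NormedAddCommGroup F₁] [NormedSpace ℝ F₁] [NormedAddCommGroup F₂] [NormedSpace ℝ F₂]
  [TopologicalSpace (TotalSpace F₁ E₁)] [∀ x, TopologicalSpace (E₁ x)] [∀ x, Zero (E₁ x)]
  [TopologicalSpace (TotalSpace F₂ E₂)] [∀ x, TopologicalSpace (E₂ x)] [∀ x, Zero (E₂ x)]
  [FiberBundle F₁ E₁] [FiberBundle F₂ E₂]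

theorem contMDiff_totalSpace_prod_iff {f : M → TotalSpace (F₁ × F₂) (E₁ ×ᵇ E₂)} :
    ContMDiff IM (IB.prod 𝓘(ℝ, F₁ × F₂)) n f ↔
      ContMDiff IM (IB.prod 𝓘(ℝ, F₁)) n
        (fun y => (⟨(f y).proj, (f y).2.1⟩ : TotalSpace F₁ E₁)) ∧
      ContMDiff IM (IB.prod 𝓘(ℝ, F₂)) n
        (fun y => (⟨(f y).proj, (f y).2.2⟩ : TotalSpace F₂ E₂)) := by
  rw [ContMDiff, ContMDiff, ContMDiff, ← forall_and]
  refine forall_congr' fun y => ?_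
  rw [contMDiffAt_totalSpace, contMDiffAt_totalSpace, contMDiffAt_totalSpace]
  rw [← and_and_left]
  refine and_congr_right fun _ => ?_
  exact contMDiffAt_prod_module_iff _

end ProdRegularity

theorem totalSpace_prod_ext {B F₁ F₂ : Type*} {E₁ E₂ : B → Type*} {x y : B} {a : E₁ y} {b : E₂ y}
    {v : E₁ x} {w : E₂ x} (h₁ : (⟨y, a⟩ : TotalSpace F₁ E₁) = ⟨x, v⟩)
    (h₂ : (⟨y, b⟩ : TotalSpace F₂ E₂) = ⟨x, w⟩) :
    (⟨y, (a, b)⟩ : TotalSpace (F₁ × F₂) (E₁ ×ᵇ E₂)) = ⟨x, (v, w)⟩ := by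
  cases h₁
  cases h₂
  rfl

/-! ### Quaternionic vector bundles -/

universe u v w

section Quaternionic

variable {EB HB : Type*} [NormedAddCommGroup EB] [NormedSpace ℝ EB] [TopologicalSpace HB]
  (I : ModelWithCorners ℝ EB HB) {J : Type u} [TopologicalSpace J] [ChartedSpace HB J]

/-- A quaternionic vector bundle of class `C^n` over `J` with model fiber `F`, where `ι : J → J` is
an involution: a complex vector bundle with a lift of `ι` to the total space which is antilinear
on the fibers and whose square is `-1`. The case `n = 0` is that of topological vector bundles and
continuous lifts, the case `n = ∞` that of smooth ones. -/
structure QuaternionicBundle (n : ℕ∞) (ι : J → J)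
    (F : Type w) [NormedAddCommGroup F] [NormedSpace ℂ F] where
  /-- The fibers. -/
  Fiber : J → Type v
  [addCommGroup : ∀ x, AddCommGroup (Fiber x)]
  [module : ∀ x, Module ℂ (Fiber x)]
  [topologicalSpaceFiber : ∀ x, TopologicalSpace (Fiber x)]
  [topologicalSpaceTotal : TopologicalSpace (TotalSpace F Fiber)]
  [fiberBundle : FiberBundle F Fiber]
  [vectorBundle : VectorBundle ℂ F Fiber]
  [contMDiffVectorBundle : ContMDiffVectorBundle n F Fiber I]
  /-- The lift of `ι`, fiber by fiber. -/
  lift : ∀ x, Fiber x →ₛₗ[starRingEnd ℂ] Fiber (ι x)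
  contMDiff_lift : ContMDiff (I.prod 𝓘(ℝ, F)) (I.prod 𝓘(ℝ, F)) n
    (fun p : TotalSpace F Fiber => (⟨ι p.proj, lift p.proj p.2⟩ : TotalSpace F Fiber))
  lift_lift : ∀ x (v : Fiber x),
    (⟨ι (ι x), lift (ι x) (lift x v)⟩ : TotalSpace F Fiber) = ⟨x, -v⟩

namespace QuaternionicBundle

variable {I} {n : ℕ∞} {ι : J → J}
  {F : Type*} [NormedAddCommGroup F] [NormedSpace ℂ F]
  {F' : Type*} [NormedAddCommGroup F'] [NormedSpace ℂ F']

attribute [instance] addCommGroup module topologicalSpaceFiber topologicalSpaceTotal fiberBundle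
  vectorBundle contMDiffVectorBundle

/-- An isomorphism of quaternionic bundles over the identity of `J`: a complex isomorphism of
bundles of class `C^n` (in both directions) that commutes with the lifts of the involution. -/
structure Iso (E : QuaternionicBundle I n ι F) (E' : QuaternionicBundle I n ι F') where
  /-- The isomorphism, fiber by fiber. -/
  toEquiv : ∀ x, E.Fiber x ≃ₗ[ℂ] E'.Fiber x
  contMDiff_toFun : ContMDiff (I.prod 𝓘(ℝ, F)) (I.prod 𝓘(ℝ, F')) n
    (fun p : TotalSpace F E.Fiber => (⟨p.proj, toEquiv p.proj p.2⟩ : TotalSpace F' E'.Fiber))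
  contMDiff_invFun : ContMDiff (I.prod 𝓘(ℝ, F')) (I.prod 𝓘(ℝ, F)) n
    (fun p : TotalSpace F' E'.Fiber =>
      (⟨p.proj, (toEquiv p.proj).symm p.2⟩ : TotalSpace F E.Fiber))
  map_lift : ∀ x (v : E.Fiber x), toEquiv (ι x) (E.lift x v) = E'.lift x (toEquiv x v)

/-- The direct sum of two quaternionic bundles, with the lift acting on each summand. -/
noncomputable def directSum (E : QuaternionicBundle.{u, v} I n ι F)
    (E' : QuaternionicBundle.{u, w} I n ι F') :
    QuaternionicBundle.{u, max v w} I n ι (F × F') where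
  Fiber := E.Fiber ×ᵇ E'.Fiber
  contMDiffVectorBundle := Bundle.Prod.contMDiffVectorBundle F E.Fiber F' E'.Fiber
  lift x :=
    { toFun := fun p => (E.lift x p.1, E'.lift x p.2)
      map_add' := fun p q => Prod.ext (map_add (E.lift x) p.1 q.1) (map_add (E'.lift x) p.2 q.2)
      map_smul' := fun c p =>
        Prod.ext ((E.lift x).map_smulₛₗ c p.1) ((E'.lift x).map_smulₛₗ c p.2) }
  contMDiff_lift := by
    have h := contMDiff_totalSpace_prod_iff.1
      (contMDiff_id (I := I.prod 𝓘(ℝ, F × F')) (n := (n : WithTop ℕ∞))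
        (M := TotalSpace (F × F') (E.Fiber ×ᵇ E'.Fiber)))
    exact contMDiff_totalSpace_prod_iff.2
      ⟨E.contMDiff_lift.comp h.1, E'.contMDiff_lift.comp h.2⟩
  lift_lift x v := totalSpace_prod_ext (E.lift_lift x v.1) (E'.lift_lift x v.2)

end QuaternionicBundle

end Quaternionic

/-! ### The trivial quaternionic line -/

/-- The complex vector space underlying `ℍ`: a pair `(a, b)` of complex numbers stands for the
quaternion `a + j b`, see `toQuaternion`. -/
abbrev QuaternionLine : Type := EuclideanSpace ℂ (Fin 2)

/-- Right multiplication by `j` on `ℍ`, in the coordinates `a + j b`: since `z j = j (conj z)` for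
complex `z`, it sends `a + j b` to `-conj b + j (conj a)`. -/
noncomputable def mulJ : QuaternionLine →ₛₗ[starRingEnd ℂ] QuaternionLine where
  toFun q := !₂[-conj (q 1), conj (q 0)]
  map_add' p q := by ext i; fin_cases i <;> simp [add_comm]
  map_smul' c p := by ext i; fin_cases i <;> simp

theorem mulJ_mulJ (q : QuaternionLine) : mulJ (mulJ q) = -q := by
  ext i; fin_cases i <;> simp [mulJ]

theorem contDiff_mulJ {n : WithTop ℕ∞} : ContDiff ℝ n mulJ := by
  let L : QuaternionLine →ₗ[ℝ] QuaternionLine :=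
    { toFun := mulJ
      map_add' := map_add mulJ
      map_smul' := fun c q => by
        have h := mulJ.map_smulₛₗ (c : ℂ) q
        rwa [Complex.conj_ofReal] at h }
  exact (LinearMap.toContinuousLinearMap L).contDiff

/-- The quaternion unit `j`. -/
def quaternionJ : ℍ[ℝ] := ⟨0, 0, 1, 0⟩

/-- The identification of `ℂ²` with `ℍ`. The next four facts say that it is a real linear
isomorphism that takes the complex scalars to right multiplication by complex numbers and `mulJ`
to right multiplication by `j`. -/
noncomputable def toQuaternion (q : QuaternionLine) : ℍ[ℝ] :=
  (q 0 : ℍ[ℝ]) + quaternionJ * (q 1 : ℍ[ℝ])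

theorem toQuaternion_components (q : QuaternionLine) :
    (toQuaternion q).re = (q 0).re ∧ (toQuaternion q).imI = (q 0).im ∧
      (toQuaternion q).imJ = (q 1).re ∧ (toQuaternion q).imK = -(q 1).im := by
  have h₀ : quaternionJ.re = 0 := rfl
  have h₁ : quaternionJ.imI = 0 := rfl
  have h₂ : quaternionJ.imJ = 1 := rfl
  have h₃ : quaternionJ.imK = 0 := rfl
  simp [toQuaternion, h₀, h₁, h₂, h₃]

theorem toQuaternion_bijective : Function.Bijective toQuaternion := by
  refine ⟨fun p q h => ?_, fun q => ⟨!₂[⟨q.re, q.imI⟩, ⟨q.imJ, -q.imK⟩], ?_⟩⟩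
  · obtain ⟨p₀, p₁, p₂, p₃⟩ := toQuaternion_components p
    obtain ⟨q₀, q₁, q₂, q₃⟩ := toQuaternion_components q
    rw [h] at p₀ p₁ p₂ p₃
    ext i
    fin_cases i
    · exact Complex.ext (p₀.symm.trans q₀) (p₁.symm.trans q₁)
    · exact Complex.ext (p₂.symm.trans q₂) (neg_injective (p₃.symm.trans q₃))
  · obtain ⟨h₀, h₁, h₂, h₃⟩ := toQuaternion_components !₂[⟨q.re, q.imI⟩, ⟨q.imJ, -q.imK⟩]
    ext
    · simpa using h₀
    · simpa using h₁
    · simpa using h₂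
    · simpa using h₃

theorem toQuaternion_add (p q : QuaternionLine) :
    toQuaternion (p + q) = toQuaternion p + toQuaternion q := by
  simp only [toQuaternion, PiLp.add_apply, Quaternion.coeComplex_add, mul_add]
  abel

theorem toQuaternion_smul (z : ℂ) (q : QuaternionLine) :
    toQuaternion (z • q) = toQuaternion q * (z : ℍ[ℝ]) := by
  simp only [toQuaternion, PiLp.smul_apply, smul_eq_mul, mul_comm z, Quaternion.coeComplex_mul,
    add_mul, mul_assoc]

theorem toQuaternion_mulJ (q : QuaternionLine) :
    toQuaternion (mulJ q) = toQuaternion q * quaternionJ := by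
  have h₀ : quaternionJ.re = 0 := rfl
  have h₁ : quaternionJ.imI = 0 := rfl
  have h₂ : quaternionJ.imJ = 1 := rfl
  have h₃ : quaternionJ.imK = 0 := rfl
  obtain ⟨q₀, q₁, q₂, q₃⟩ := toQuaternion_components q
  obtain ⟨p₀, p₁, p₂, p₃⟩ := toQuaternion_components (mulJ q)
  ext
  · rw [p₀]
    simp [h₀, h₁, h₂, h₃, q₂, mulJ]
  · rw [p₁]
    simp [h₀, h₁, h₂, h₃, q₃, mulJ]
  · rw [p₂]
    simp [h₀, h₁, h₂, h₃, q₀, mulJ]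
  · rw [p₃]
    simp [h₀, h₁, h₂, h₃, q₁, mulJ]

section TrivialLine

variable {EB HB : Type*} [NormedAddCommGroup EB] [NormedSpace ℝ EB] [TopologicalSpace HB]
  (I : ModelWithCorners ℝ EB HB) {J : Type u} [TopologicalSpace J] [ChartedSpace HB J]

/-- The trivial quaternionic bundle `J × ℍ` of complex rank two, with the lift
`(x, q) ↦ (ι x, q j)`. -/
noncomputable def QuaternionicBundle.trivialLine (n : ℕ∞) (ι : J → J) (hι : ContMDiff I I n ι)
    (hι' : Function.Involutive ι) : QuaternionicBundle.{u, 0} I n ι QuaternionLine where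
  Fiber := Bundle.Trivial J QuaternionLine
  contMDiffVectorBundle := Bundle.Trivial.contMDiffVectorBundle QuaternionLine
  lift _ := mulJ
  contMDiff_lift := by
    have h : ContMDiff (I.prod 𝓘(ℝ, QuaternionLine)) 𝓘(ℝ, QuaternionLine) n
        (fun p : TotalSpace QuaternionLine (Bundle.Trivial J QuaternionLine) => p.2) :=
      fun p => (contMDiffAt_totalSpace.1 (contMDiffAt_id (x := p))).2
    exact fun p => contMDiffAt_totalSpace.2
      ⟨(hι.comp (contMDiff_proj _)) p, (contDiff_mulJ.contMDiff.comp h) p⟩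
  lift_lift x v := by
    rw [hι' x]
    exact congrArg (TotalSpace.mk x) (mulJ_mulJ v)

end TrivialLine

set_option linter.unusedSectionVars false

open Set Filter Topology Function

/-! ### Regularity of maps into spaces of linear maps -/

section PointwiseRegularity

variable {E H M V W : Type*} [NormedAddCommGroup E] [NormedSpace ℝ E] [TopologicalSpace H]
  {I : ModelWithCorners ℝ E H} [TopologicalSpace M] [ChartedSpace H M]
  [NormedAddCommGroup V] [NormedSpace ℝ V] [FiniteDimensional ℝ V]
  [NormedAddCommGroup W] [NormedSpace ℝ W] {n : WithTop ℕ∞}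

/-! For a section `s` of `E` let `σ s` be the section `x ↦ lift (s (ι x))` (`liftSection`). The
operator `σ` is antilinear on sections and `σ² = -1`. The theorem reduces to finding a section `s`
of class `C^n` for which `s` and `σ s` are complex linearly independent at every point.

Such a section splits off the line: `h ↦ h₀ s + h₁ σ s` is an equivariant embedding of the trivial
quaternionic line. A functional `p` with `p s = 1` and `p (σ s) = 0` exists locally by Cramer's rule
and globally by a partition of unity, since these conditions are affine. Made equivariant, `p`
becomes a left inverse of the embedding, and `E'` is its kernel (`exists_iso_directSum_of_section`).

To find `s`, note that at a fixed point independence only means `s x ≠ 0`, because an antilinear map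
of square `-1` has no eigenvector. As fixed points are isolated, a section nonzero at all of them
exists, and it is independent near the fixed set. Elsewhere there are neighbourhoods disjoint from
their image under `ι`. Over such a neighbourhood `s` and `σ s` can be changed independently of each
other, since `σ s` there is determined by `s` on the image. Linearly dependent pairs in `F × F` form
a set of real dimension `dim F + 2` in a space of real dimension `2 dim F`, so a generic small
perturbation avoids them over a `k`-dimensional base when `k + 2 < dim F = 4l`, which is the
hypothesis (`exists_linearIndependent_add`, `exists_perturbation`). A locally finite sequence of
such perturbations, each preserving independence on the closed set already treated, gives the
section (`exists_section_isIndependentAt`). -/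

theorem contMDiffOn_clm_of_apply {f : M → V →L[ℝ] W} {s : Set M}
    (h : ∀ v, ContMDiffOn I 𝓘(ℝ, W) n (fun x => f x v) s) :
    ContMDiffOn I 𝓘(ℝ, V →L[ℝ] W) n f s := by
  let b := Module.finBasis ℝ V
  let c (i : Fin (Module.finrank ℝ V)) : V →L[ℝ] ℝ := LinearMap.toContinuousLinearMap (b.coord i)
  have hf : f = fun x => ∑ i, ContinuousLinearMap.smulRightL ℝ V W (c i) (f x (b i)) := by
    funext x
    ext v
    rw [_root_.sum_apply]
    conv_lhs => rw [← b.sum_repr v, map_sum]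
    simp [c]
  rw [hf]
  exact contMDiffOn_finsetSum fun i _ =>
    (ContinuousLinearMap.contMDiff _).comp_contMDiffOn (h (b i))

end PointwiseRegularity

section LocalSections

variable {EB HB B F : Type*} {E : B → Type*} [NormedAddCommGroup EB] [NormedSpace ℝ EB]
  [TopologicalSpace HB] {I : ModelWithCorners ℝ EB HB} [TopologicalSpace B] [ChartedSpace HB B]
  [NormedAddCommGroup F] [NormedSpace ℂ F]
  [∀ x, AddCommGroup (E x)] [∀ x, Module ℂ (E x)] [∀ x, TopologicalSpace (E x)]
  [TopologicalSpace (TotalSpace F E)] [FiberBundle F E] [VectorBundle ℂ F E]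
  {n : WithTop ℕ∞} [ContMDiffVectorBundle n F E I]

theorem contMDiffOn_symm_mk (e : Trivialization F (π F E)) [MemTrivializationAtlas e]
    {f : B → F} {s : Set B} (hs : IsOpen s) (hse : s ⊆ e.baseSet)
    (hf : ContMDiffOn I 𝓘(ℝ, F) n f s) :
    ContMDiffOn I (I.prod 𝓘(ℝ, F)) n
      (fun x => TotalSpace.mk' F (E := E) x (e.symm x (f x))) s := by
  rw [e.contMDiffOn_section_iff hs hse]
  refine hf.congr fun x hx => ?_
  rw [e.apply_mk_symm (hse hx)]

end LocalSections

/-! ### The kernel of a bundle map to a trivial bundle -/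

section KernelBundle

variable {EB HB B F G F' : Type*} {E : B → Type*} [NormedAddCommGroup EB] [NormedSpace ℝ EB]
  [TopologicalSpace HB] {I : ModelWithCorners ℝ EB HB} [TopologicalSpace B] [ChartedSpace HB B]
  [NormedAddCommGroup F] [NormedSpace ℂ F] [FiniteDimensional ℂ F]
  [NormedAddCommGroup G] [NormedSpace ℂ G]
  [NormedAddCommGroup F'] [NormedSpace ℂ F']
  [∀ x, AddCommGroup (E x)] [∀ x, Module ℂ (E x)] [∀ x, TopologicalSpace (E x)]
  [TopologicalSpace (TotalSpace F E)] [FiberBundle F E] [VectorBundle ℂ F E]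
  {n : WithTop ℕ∞}

/-- The family of maps `(P, q)` in a trivialization `e`, where `P` is a family of linear maps on
the fibers and `q` is a fixed linear map on the model fiber. -/
noncomputable def kernelCoord (P : ∀ x, E x →ₗ[ℂ] G) (e : Trivialization F (π F E))
    [MemTrivializationAtlas e] (q : F →L[ℂ] F') (x : B) : F →L[ℝ] G × F' :=
  LinearMap.toContinuousLinearMap
    (((P x ∘ₗ e.symmₗ ℂ x).prod (q : F →ₗ[ℂ] F')).restrictScalars ℝ)

theorem kernelCoord_apply (P : ∀ x, E x →ₗ[ℂ] G) (e : Trivialization F (π F E))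
    [MemTrivializationAtlas e] (q : F →L[ℂ] F') {x : B} (hx : x ∈ e.baseSet) (v : F) :
    kernelCoord P e q x v = (P x (e.symm x v), q v) := by
  have : e.symmₗ ℂ x v = e.symm x v := by rw [e.coe_symmₗ hx]
  simp [kernelCoord, this]

/-- The points of the base set of `e` at which `(P, q)` is invertible. -/
def kernelBaseSet (P : ∀ x, E x →ₗ[ℂ] G) (e : Trivialization F (π F E))
    [MemTrivializationAtlas e] (q : F →L[ℂ] F') : Set B :=
  e.baseSet ∩ {x | (kernelCoord P e q x).IsInvertible}

/-- The fiber of the kernel of `P`; the family `q` is used to define its topology. -/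
def KernelFiber (P : ∀ x, E x →ₗ[ℂ] G) (_q : B → F →L[ℂ] F') (x : B) : Type _ :=
  LinearMap.ker (P x)

variable {P : ∀ x, E x →ₗ[ℂ] G} {q : B → F →L[ℂ] F'}

noncomputable instance (x : B) : AddCommGroup (KernelFiber P q x) :=
  inferInstanceAs (AddCommGroup (LinearMap.ker (P x)))

noncomputable instance (x : B) : Module ℂ (KernelFiber P q x) :=
  inferInstanceAs (Module ℂ (LinearMap.ker (P x)))

/-- The inclusion of the kernel. -/
noncomputable def KernelFiber.incl (P : ∀ x, E x →ₗ[ℂ] G) (q : B → F →L[ℂ] F') (x : B) :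
    KernelFiber P q x →ₗ[ℂ] E x :=
  (LinearMap.ker (P x)).subtype

theorem KernelFiber.incl_injective (x : B) : Injective (KernelFiber.incl P q x) :=
  Subtype.val_injective

theorem KernelFiber.apply_incl {x : B} (v : KernelFiber P q x) :
    P x (KernelFiber.incl P q x v) = 0 :=
  LinearMap.mem_ker.1 v.2

/-- The element of the kernel given by an element of `E x` on which `P` vanishes. -/
def KernelFiber.mk (q : B → F →L[ℂ] F') {x : B} (v : E x) (hv : P x v = 0) : KernelFiber P q x :=
  ⟨v, LinearMap.mem_ker.2 hv⟩

@[simp]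
theorem KernelFiber.incl_mk {x : B} (v : E x) (hv : P x v = 0) :
    KernelFiber.incl P q x (KernelFiber.mk q v hv) = v :=
  rfl

/-- The topology is induced by the very coordinate used later to trivialize the kernel around `x`,
so that the inclusion of the fiber into the total space is inducing by definition. -/
noncomputable instance (x : B) : TopologicalSpace (KernelFiber P q x) :=
  TopologicalSpace.induced
    (fun v => q x (trivializationAt F E x ⟨x, KernelFiber.incl P q x v⟩).2) inferInstance

/-- Where `(P, q₀)` is invertible, its inverse on `{0} × F'` parametrizes the kernel of `P`, with
`q₀` as the coordinate. This is the local trivialization of the kernel. -/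
theorem KernelFiber.apply_symm_inverse {e : Trivialization F (π F E)} [MemTrivializationAtlas e]
    {q₀ : F →L[ℂ] F'} {x : B} (hx : x ∈ kernelBaseSet P e q₀) (w : F') :
    P x (e.symm x ((kernelCoord P e q₀ x).inverse (0, w))) = 0 ∧
      q₀ ((kernelCoord P e q₀ x).inverse (0, w)) = w := by
  have h := hx.2.self_apply_inverse (0, w)
  rw [kernelCoord_apply P e q₀ hx.1] at h
  exact ⟨congrArg Prod.fst h, congrArg Prod.snd h⟩

theorem KernelFiber.inverse_apply {e : Trivialization F (π F E)} [MemTrivializationAtlas e]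
    {q₀ : F →L[ℂ] F'} {x : B} (hx : x ∈ kernelBaseSet P e q₀) (v : KernelFiber P q x) :
    (kernelCoord P e q₀ x).inverse (0, q₀ (e ⟨x, KernelFiber.incl P q x v⟩).2) =
      (e ⟨x, KernelFiber.incl P q x v⟩).2 := by
  rw [hx.2.inverse_apply_eq, kernelCoord_apply P e q₀ hx.1, e.symm_apply_apply_mk hx.1,
    KernelFiber.apply_incl]

section Regularity

variable [ContMDiffVectorBundle n F E I]

theorem contMDiffOn_kernelCoord
    (hP : ContMDiff (I.prod 𝓘(ℝ, F)) 𝓘(ℝ, G) n (fun v : TotalSpace F E => P v.proj v.2))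
    (e : Trivialization F (π F E)) [MemTrivializationAtlas e] (q₀ : F →L[ℂ] F') :
    ContMDiffOn I 𝓘(ℝ, F →L[ℝ] G × F') n (kernelCoord P e q₀) e.baseSet := by
  refine contMDiffOn_clm_of_apply fun v => ?_
  have h₁ := hP.comp_contMDiffOn
    (contMDiffOn_symm_mk (I := I) (n := n) e e.open_baseSet subset_rfl
      (contMDiffOn_const (c := v)))
  exact (h₁.prodMk_space contMDiffOn_const).congr fun x hx => kernelCoord_apply P e q₀ hx v

theorem isOpen_kernelBaseSet
    (hP : ContMDiff (I.prod 𝓘(ℝ, F)) 𝓘(ℝ, G) n (fun v : TotalSpace F E => P v.proj v.2))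
    (e : Trivialization F (π F E)) [MemTrivializationAtlas e] (q₀ : F →L[ℂ] F') :
    IsOpen (kernelBaseSet P e q₀) := by
  have : CompleteSpace F := FiniteDimensional.complete ℂ F
  exact (contMDiffOn_kernelCoord hP e q₀).continuousOn.isOpen_inter_preimage e.open_baseSet
    (ContinuousLinearEquiv.isOpen (𝕜 := ℝ) (E := F) (F := G × F'))

theorem contMDiffOn_inverse_kernelCoord
    (hP : ContMDiff (I.prod 𝓘(ℝ, F)) 𝓘(ℝ, G) n (fun v : TotalSpace F E => P v.proj v.2))
    (e : Trivialization F (π F E)) [MemTrivializationAtlas e] (q₀ : F →L[ℂ] F') :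
    ContMDiffOn I 𝓘(ℝ, G × F' →L[ℝ] F) n (fun x => (kernelCoord P e q₀ x).inverse)
      (kernelBaseSet P e q₀) := by
  have : CompleteSpace F := FiniteDimensional.complete ℂ F
  intro x hx
  obtain ⟨A, hA⟩ := hx.2
  have h := contDiffAt_map_inverse (𝕜 := ℝ) (n := n) A
  rw [hA] at h
  exact h.contMDiffAt.comp_contMDiffWithinAt x
    ((contMDiffOn_kernelCoord hP e q₀ x hx.1).mono inter_subset_left)

end Regularity

end KernelBundle

/-! ### The kernel as a vector bundle of class `C^n`. -/

section KernelBundle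

variable {EB HB B F G F' : Type*} {E : B → Type*} [NormedAddCommGroup EB] [NormedSpace ℝ EB]
  [TopologicalSpace HB] {I : ModelWithCorners ℝ EB HB} [TopologicalSpace B] [ChartedSpace HB B]
  [NormedAddCommGroup F] [NormedSpace ℂ F] [FiniteDimensional ℂ F]
  [NormedAddCommGroup G] [NormedSpace ℂ G]
  [NormedAddCommGroup F'] [NormedSpace ℂ F']
  [∀ x, AddCommGroup (E x)] [∀ x, Module ℂ (E x)] [∀ x, TopologicalSpace (E x)]
  [TopologicalSpace (TotalSpace F E)] [FiberBundle F E] [VectorBundle ℂ F E]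
  {n : WithTop ℕ∞} {P : ∀ x, E x →ₗ[ℂ] G} {q : B → F →L[ℂ] F'}
  [ContMDiffVectorBundle n F E I]

open Classical in
/-- The pretrivialization of the kernel of `P` obtained from a trivialization `e` and a linear map
`q₀` complementary to `P`. -/
noncomputable def kernelPretrivialization
    (hP : ContMDiff (I.prod 𝓘(ℝ, F)) 𝓘(ℝ, G) n (fun v : TotalSpace F E => P v.proj v.2))
    (q : B → F →L[ℂ] F') (e : Trivialization F (π F E)) [MemTrivializationAtlas e]
    (q₀ : F →L[ℂ] F') : Pretrivialization F' (π F' (KernelFiber P q)) where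
  toFun v := (v.proj, q₀ (e ⟨v.proj, KernelFiber.incl P q v.proj v.2⟩).2)
  invFun z :=
    -- Outside the base set the value is a dummy; it lies outside the target.
    if hz : z.1 ∈ kernelBaseSet P e q₀ then
      ⟨z.1, KernelFiber.mk q _ (KernelFiber.apply_symm_inverse hz z.2).1⟩
    else ⟨z.1, 0⟩
  source := π F' (KernelFiber P q) ⁻¹' kernelBaseSet P e q₀
  target := kernelBaseSet P e q₀ ×ˢ univ
  map_source' v hv := ⟨hv, mem_univ _⟩
  map_target' z hz := by
    rw [dif_pos hz.1]
    exact hz.1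
  left_inv' v hv := by
    rw [mem_preimage] at hv
    rw [dif_pos hv]
    refine congrArg (TotalSpace.mk v.proj) (KernelFiber.incl_injective v.proj ?_)
    rw [KernelFiber.incl_mk, KernelFiber.inverse_apply hv, e.symm_apply_apply_mk hv.1]
  right_inv' z hz := by
    rw [dif_pos hz.1]
    refine Prod.ext rfl ?_
    simp only [KernelFiber.incl_mk]
    rw [e.apply_mk_symm hz.1.1, (KernelFiber.apply_symm_inverse hz.1 z.2).2]
  open_target := (isOpen_kernelBaseSet hP e q₀).prod isOpen_univ
  baseSet := kernelBaseSet P e q₀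
  open_baseSet := isOpen_kernelBaseSet hP e q₀
  source_eq := rfl
  target_eq := rfl
  proj_toFun _ _ := rfl

variable (hP : ContMDiff (I.prod 𝓘(ℝ, F)) 𝓘(ℝ, G) n (fun v : TotalSpace F E => P v.proj v.2))

theorem kernelPretrivialization_apply (e : Trivialization F (π F E)) [MemTrivializationAtlas e]
    (q₀ : F →L[ℂ] F') (v : TotalSpace F' (KernelFiber P q)) :
    kernelPretrivialization hP q e q₀ v =
      (v.proj, q₀ (e ⟨v.proj, KernelFiber.incl P q v.proj v.2⟩).2) :=
  rfl

theorem incl_kernelPretrivialization_symm (e : Trivialization F (π F E))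
    [MemTrivializationAtlas e] (q₀ : F →L[ℂ] F') {x : B} (hx : x ∈ kernelBaseSet P e q₀) (w : F') :
    KernelFiber.incl P q x ((kernelPretrivialization hP q e q₀).symm x w) =
      e.symm x ((kernelCoord P e q₀ x).inverse (0, w)) := by
  have h := congrArg (KernelFiber.incl P q x)
    ((kernelPretrivialization hP q e q₀).symm_apply_apply_mk hx
      (KernelFiber.mk q _ (KernelFiber.apply_symm_inverse hx w).1))
  rw [kernelPretrivialization_apply] at h
  simp only [KernelFiber.incl_mk] at h
  rwa [e.apply_mk_symm hx.1, (KernelFiber.apply_symm_inverse hx w).2] at h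

instance isLinear_kernelPretrivialization (e : Trivialization F (π F E))
    [MemTrivializationAtlas e] (q₀ : F →L[ℂ] F') :
    (kernelPretrivialization hP q e q₀).IsLinear ℂ where
  linear x hx := by
    have h := e.linear ℂ hx.1
    constructor
    · intro v w
      simp only [kernelPretrivialization_apply, map_add, h.map_add]
    · intro c v
      simp only [kernelPretrivialization_apply, map_smul, h.map_smul]

/-- The change of coordinates between two pretrivializations of the kernel. -/
theorem contMDiffOn_kernelPretrivialization_symm (e e' : Trivialization F (π F E))
    [MemTrivializationAtlas e] [MemTrivializationAtlas e'] (q₀ q₁ : F →L[ℂ] F') (w : F') :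
    ContMDiffOn I 𝓘(ℝ, F') n
      (fun x => (kernelPretrivialization hP q e' q₁
        ⟨x, (kernelPretrivialization hP q e q₀).symm x w⟩).2)
      (kernelBaseSet P e q₀ ∩ kernelBaseSet P e' q₁) := by
  have hopen := (isOpen_kernelBaseSet hP e q₀).inter (isOpen_kernelBaseSet hP e' q₁)
  have h₁ := ((contMDiffOn_inverse_kernelCoord hP e q₀).clm_apply
    (contMDiffOn_const (c := ((0 : G), w)))).mono
    (inter_subset_left (t := kernelBaseSet P e' q₁))
  have h₂ := contMDiffOn_symm_mk (I := I) (n := n) e hopen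
    (fun x hx => hx.1.1) h₁
  rw [e'.contMDiffOn_section_iff hopen fun x hx => hx.2.1] at h₂
  refine ((q₁.restrictScalars ℝ).contMDiff.comp_contMDiffOn h₂).congr fun x hx => ?_
  rw [kernelPretrivialization_apply]
  simp only [incl_kernelPretrivialization_symm hP e q₀ hx.1]
  rfl

theorem exists_kernel_coordChange [FiniteDimensional ℂ F'] (e e' : Trivialization F (π F E))
    [MemTrivializationAtlas e] [MemTrivializationAtlas e'] (q₀ q₁ : F →L[ℂ] F') :
    ∃ f : B → F' →L[ℂ] F', ContinuousOn f (kernelBaseSet P e q₀ ∩ kernelBaseSet P e' q₁) ∧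
      ContMDiffOn I 𝓘(ℝ, F' →L[ℝ] F') n (fun x => (f x).restrictScalars ℝ)
        (kernelBaseSet P e q₀ ∩ kernelBaseSet P e' q₁) ∧
      ∀ x ∈ kernelBaseSet P e q₀ ∩ kernelBaseSet P e' q₁, ∀ w, f x w =
        (kernelPretrivialization hP q e' q₁
          ⟨x, (kernelPretrivialization hP q e q₀).symm x w⟩).2 := by
  let f (x : B) : F' →L[ℂ] F' := LinearMap.toContinuousLinearMap
    ((kernelPretrivialization hP q e' q₁).linearMapAt ℂ x ∘ₗ
      (kernelPretrivialization hP q e q₀).symmₗ ℂ x)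
  have hf : ∀ x ∈ kernelBaseSet P e q₀ ∩ kernelBaseSet P e' q₁, ∀ w, f x w =
      (kernelPretrivialization hP q e' q₁
        ⟨x, (kernelPretrivialization hP q e q₀).symm x w⟩).2 := by
    intro x hx w
    simp only [f, LinearMap.coe_toContinuousLinearMap', LinearMap.comp_apply]
    rw [Pretrivialization.coe_linearMapAt_of_mem _ hx.2, Pretrivialization.symmₗ_apply ℂ _ hx.1]
  have hw := contMDiffOn_kernelPretrivialization_symm (q := q) hP e e' q₀ q₁
  refine ⟨f, continuousOn_clm_apply.2 fun w => ?_, contMDiffOn_clm_of_apply fun w => ?_, hf⟩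
  · exact (hw w).continuousOn.congr fun x hx => hf x hx w
  · exact (hw w).congr fun x hx => hf x hx w

/-- The kernel of `P` as a vector prebundle. -/
noncomputable def kernelPrebundle [FiniteDimensional ℂ F']
    (hq : ∀ x, x ∈ kernelBaseSet P (trivializationAt F E x) (q x)) :
    VectorPrebundle ℂ F' (KernelFiber P q) where
  pretrivializationAtlas :=
    range fun x => kernelPretrivialization hP q (trivializationAt F E x) (q x)
  pretrivialization_linear' := by
    rintro _ ⟨x, rfl⟩
    infer_instance
  pretrivializationAt x := kernelPretrivialization hP q (trivializationAt F E x) (q x)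
  mem_base_pretrivializationAt x := hq x
  pretrivialization_mem_atlas x := ⟨x, rfl⟩
  exists_coordChange := by
    rintro _ ⟨x, rfl⟩ _ ⟨y, rfl⟩
    obtain ⟨f, hf, -, hf'⟩ := exists_kernel_coordChange (q := q) hP (trivializationAt F E x)
      (trivializationAt F E y) (q x) (q y)
    exact ⟨f, hf, hf'⟩
  totalSpaceMk_isInducing x := by
    exact (isInducing_const_prod (x := x)).2 ⟨rfl⟩

section

variable [FiniteDimensional ℂ F'] (hq : ∀ x, x ∈ kernelBaseSet P (trivializationAt F E x) (q x))

theorem kernelPrebundle_contMDiffVectorBundle :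
    letI := (kernelPrebundle hP hq).totalSpaceTopology
    letI := (kernelPrebundle hP hq).toFiberBundle
    letI := (kernelPrebundle hP hq).toVectorBundle
    ContMDiffVectorBundle n F' (KernelFiber P q) I := by
  let := (kernelPrebundle hP hq).totalSpaceTopology
  let := (kernelPrebundle hP hq).toFiberBundle
  let := (kernelPrebundle hP hq).toVectorBundle
  constructor
  rintro _ _ ⟨_, ⟨x, rfl⟩, rfl⟩ ⟨_, ⟨y, rfl⟩, rfl⟩
  obtain ⟨f, -, hf, hf'⟩ := exists_kernel_coordChange (q := q) hP (trivializationAt F E x)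
    (trivializationAt F E y) (q x) (q y)
  refine hf.congr fun b hb => ?_
  ext w
  rw [ContinuousLinearEquiv.coe_coe, Trivialization.coordChangeL_apply]
  · exact (hf' b hb w).symm
  · exact hb

theorem contMDiff_kernel_incl :
    letI := (kernelPrebundle hP hq).totalSpaceTopology
    letI := (kernelPrebundle hP hq).toFiberBundle
    ContMDiff (I.prod 𝓘(ℝ, F')) (I.prod 𝓘(ℝ, F)) n
      (fun v : TotalSpace F' (KernelFiber P q) =>
        TotalSpace.mk' F v.proj (KernelFiber.incl P q v.proj v.2)) := by
  let := (kernelPrebundle hP hq).totalSpaceTopology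
  let := (kernelPrebundle hP hq).toFiberBundle
  intro v
  obtain ⟨h₁, h₂⟩ := contMDiffAt_totalSpace.1
    (contMDiffAt_id (I := I.prod 𝓘(ℝ, F')) (n := n) (x := v))
  refine contMDiffAt_totalSpace.2 ⟨h₁, ?_⟩
  have hopen := isOpen_kernelBaseSet hP (trivializationAt F E v.proj) (q v.proj)
  have h₃ := ((contMDiffOn_inverse_kernelCoord hP (trivializationAt F E v.proj)
    (q v.proj)).contMDiffAt (hopen.mem_nhds (hq v.proj))).comp v h₁
  refine (h₃.clm_apply ((contMDiffAt_const (c := (0 : G))).prodMk_space h₂)).congr_of_eventuallyEq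
    ?_
  filter_upwards [h₁.continuousAt.preimage_mem_nhds (hopen.mem_nhds (hq v.proj))] with y hy
  exact (KernelFiber.inverse_apply hy y.2).symm

/-- The coordinate of the kernel near a point is a fixed linear map applied to the coordinate of
`E`. Together with `contMDiff_kernel_incl` this allows regularity questions about the kernel to be
settled in `E`. -/
theorem contMDiff_kernel_of_incl {EM HM M : Type*} [NormedAddCommGroup EM] [NormedSpace ℝ EM]
    [TopologicalSpace HM] {IM : ModelWithCorners ℝ EM HM} [TopologicalSpace M] [ChartedSpace HM M]
    {f : M → TotalSpace F' (KernelFiber P q)}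
    (hf : ContMDiff IM (I.prod 𝓘(ℝ, F)) n
      (fun y => TotalSpace.mk' F (f y).proj (KernelFiber.incl P q (f y).proj (f y).2))) :
    letI := (kernelPrebundle hP hq).totalSpaceTopology
    letI := (kernelPrebundle hP hq).toFiberBundle
    ContMDiff IM (I.prod 𝓘(ℝ, F')) n f := by
  let := (kernelPrebundle hP hq).totalSpaceTopology
  let := (kernelPrebundle hP hq).toFiberBundle
  intro y
  obtain ⟨h₁, h₂⟩ := contMDiffAt_totalSpace.1 (hf y)
  exact contMDiffAt_totalSpace.2
    ⟨h₁, ((q (f y).proj).restrictScalars ℝ).contMDiff.contMDiffAt.comp y h₂⟩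

end

theorem exists_mem_kernelBaseSet [FiniteDimensional ℂ F'] [FiniteDimensional ℂ G]
    (hsurj : ∀ x, Surjective (P x))
    (hdim : Module.finrank ℂ G + Module.finrank ℂ F' = Module.finrank ℂ F) (x : B) :
    ∃ q₀ : F →L[ℂ] F', x ∈ kernelBaseSet P (trivializationAt F E x) q₀ := by
  set e := trivializationAt F E x
  have hx : x ∈ e.baseSet := mem_baseSet_trivializationAt F E x
  let Q : F →ₗ[ℂ] G := P x ∘ₗ e.symmₗ ℂ x
  have hQ : Surjective Q := by
    refine (hsurj x).comp ?_
    rw [e.coe_symmₗ hx]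
    exact fun v => ⟨_, e.symm_apply_apply_mk hx v⟩
  have hker : Module.finrank ℂ (LinearMap.ker Q) = Module.finrank ℂ F' := by
    have := Q.finrank_range_add_finrank_ker
    rw [LinearMap.range_eq_top.2 hQ, finrank_top] at this
    omega
  let A : LinearMap.ker Q ≃ₗ[ℂ] F' := LinearEquiv.ofFinrankEq _ _ hker
  obtain ⟨r, hr⟩ := (LinearMap.ker Q).subtype.exists_leftInverse_of_injective
    (LinearMap.ker Q).ker_subtype
  -- Since `r` is a retraction onto `ker Q`, the map `A ∘ r` is injective there; hence `(Q, A ∘ r)`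
  -- is injective, and equality of dimensions makes it invertible.
  refine ⟨LinearMap.toContinuousLinearMap (A.toLinearMap ∘ₗ r), hx, ?_⟩
  have hinj : Injective (kernelCoord P e (LinearMap.toContinuousLinearMap (A.toLinearMap ∘ₗ r)) x)
      := by
    rw [injective_iff_map_eq_zero]
    intro v hv
    have h₁ : Q v = 0 := congrArg Prod.fst hv
    have h₂ : A (r v) = 0 := congrArg Prod.snd hv
    have h₃ := LinearMap.congr_fun hr ⟨v, LinearMap.mem_ker.2 h₁⟩
    rw [LinearEquiv.map_eq_zero_iff] at h₂
    simp only [LinearMap.comp_apply, Submodule.subtype_apply, h₂, LinearMap.id_apply] at h₃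
    exact congrArg Subtype.val h₃.symm
  have hfin : Module.finrank ℝ F = Module.finrank ℝ (G × F') := by
    rw [Module.finrank_prod, finrank_real_of_complex, finrank_real_of_complex,
      finrank_real_of_complex]
    omega
  let L := LinearEquiv.ofInjectiveOfFinrankEq (kernelCoord P e
    (LinearMap.toContinuousLinearMap (A.toLinearMap ∘ₗ r)) x : F →ₗ[ℝ] G × F') hinj hfin
  exact ⟨L.toContinuousLinearEquiv, by ext v <;> rfl⟩

end KernelBundle

/-! ### Maps into the total space of a complex bundle -/

section Along

variable {EB HB B F M EM HM : Type*} {E : B → Type*} [NormedAddCommGroup EB] [NormedSpace ℝ EB]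
  [TopologicalSpace HB] {I : ModelWithCorners ℝ EB HB} [TopologicalSpace B] [ChartedSpace HB B]
  [NormedAddCommGroup F] [NormedSpace ℂ F]
  [∀ x, AddCommGroup (E x)] [∀ x, Module ℂ (E x)] [∀ x, TopologicalSpace (E x)]
  [TopologicalSpace (TotalSpace F E)] [FiberBundle F E] [VectorBundle ℂ F E]
  [NormedAddCommGroup EM] [NormedSpace ℝ EM] [TopologicalSpace HM]
  {IM : ModelWithCorners ℝ EM HM} [TopologicalSpace M] [ChartedSpace HM M] {n : WithTop ℕ∞}
  {b : M → B} {f g : ∀ y, E (b y)}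

theorem contMDiff_mk_add
    (hf : ContMDiff IM (I.prod 𝓘(ℝ, F)) n (fun y => TotalSpace.mk' F (b y) (f y)))
    (hg : ContMDiff IM (I.prod 𝓘(ℝ, F)) n (fun y => TotalSpace.mk' F (b y) (g y))) :
    ContMDiff IM (I.prod 𝓘(ℝ, F)) n (fun y => TotalSpace.mk' F (b y) (f y + g y)) := by
  intro y
  obtain ⟨h₁, h₂⟩ := contMDiffAt_totalSpace.1 (hf y)
  obtain ⟨-, h₃⟩ := contMDiffAt_totalSpace.1 (hg y)
  refine contMDiffAt_totalSpace.2 ⟨h₁, (h₂.add h₃).congr_of_eventuallyEq ?_⟩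
  filter_upwards [h₁.continuousAt.preimage_mem_nhds
    ((trivializationAt F E (b y)).open_baseSet.mem_nhds (mem_baseSet_trivializationAt F E (b y)))]
    with z hz
  exact ((trivializationAt F E (b y)).linear ℂ hz).map_add _ _

theorem contMDiff_mk_smul {c : M → ℂ} (hc : ContMDiff IM 𝓘(ℝ, ℂ) n c)
    (hf : ContMDiff IM (I.prod 𝓘(ℝ, F)) n (fun y => TotalSpace.mk' F (b y) (f y))) :
    ContMDiff IM (I.prod 𝓘(ℝ, F)) n (fun y => TotalSpace.mk' F (b y) (c y • f y)) := by
  intro y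
  obtain ⟨h₁, h₂⟩ := contMDiffAt_totalSpace.1 (hf y)
  have h₃ : ContMDiffAt IM 𝓘(ℝ, F) n
      (fun z => c z • (trivializationAt F E (b y) (TotalSpace.mk' F (b z) (f z))).2) y :=
    ((isBoundedBilinearMap_smul (𝕜 := ℝ) (A := ℂ) (E := F)).contDiff.contMDiff.contMDiffAt).comp
      y ((hc y).prodMk_space h₂)
  refine contMDiffAt_totalSpace.2 ⟨h₁, h₃.congr_of_eventuallyEq ?_⟩
  filter_upwards [h₁.continuousAt.preimage_mem_nhds
    ((trivializationAt F E (b y)).open_baseSet.mem_nhds (mem_baseSet_trivializationAt F E (b y)))]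
    with z hz
  exact ((trivializationAt F E (b y)).linear ℂ hz).map_smul _ _

theorem contMDiff_mk_sub
    (hf : ContMDiff IM (I.prod 𝓘(ℝ, F)) n (fun y => TotalSpace.mk' F (b y) (f y)))
    (hg : ContMDiff IM (I.prod 𝓘(ℝ, F)) n (fun y => TotalSpace.mk' F (b y) (g y))) :
    ContMDiff IM (I.prod 𝓘(ℝ, F)) n (fun y => TotalSpace.mk' F (b y) (f y - g y)) := by
  have h := contMDiff_mk_add hf (contMDiff_mk_smul (contMDiff_const (c := (-1 : ℂ))) hg)
  simpa only [neg_one_smul, ← sub_eq_add_neg] using h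

end Along

/-! ### Functionals dual to a pair of independent sections -/

section Functional

section ComplexValued

variable {EM HM M F : Type*} [NormedAddCommGroup EM] [NormedSpace ℝ EM] [TopologicalSpace HM]
  {IM : ModelWithCorners ℝ EM HM} [TopologicalSpace M] [ChartedSpace HM M]
  [NormedAddCommGroup F] [NormedSpace ℂ F] {n : WithTop ℕ∞} {s : Set M}

theorem contMDiffOn_complexDual (Λ : F →L[ℂ] ℂ) {f : M → F} (hf : ContMDiffOn IM 𝓘(ℝ, F) n f s) :
    ContMDiffOn IM 𝓘(ℝ, ℂ) n (fun x => Λ (f x)) s :=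
  (Λ.restrictScalars ℝ).contMDiff.comp_contMDiffOn hf

theorem contMDiffOn_complex_mul {f g : M → ℂ} (hf : ContMDiffOn IM 𝓘(ℝ, ℂ) n f s)
    (hg : ContMDiffOn IM 𝓘(ℝ, ℂ) n g s) : ContMDiffOn IM 𝓘(ℝ, ℂ) n (fun x => f x * g x) s :=
  (contDiff_mul (𝕜 := ℝ) (𝔸 := ℂ)).contMDiff.comp_contMDiffOn (hf.prodMk_space hg)

end ComplexValued

theorem exists_dual_pair {F : Type*} [NormedAddCommGroup F] [NormedSpace ℂ F]
    [FiniteDimensional ℂ F] {a b : F} (h : LinearIndependent ℂ ![a, b]) :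
    ∃ A B : F →L[ℂ] ℂ, A a = 1 ∧ A b = 0 ∧ B a = 0 ∧ B b = 1 := by
  obtain ⟨r, hr⟩ := (Fintype.linearCombination ℂ ![a, b]).exists_leftInverse_of_injective
    (LinearMap.ker_eq_bot.2 (linearIndependent_iff_injective_fintypeLinearCombination.1 h))
  have ha : r a = ![1, 0] := by
    simpa [Fintype.linearCombination_apply] using LinearMap.congr_fun hr ![1, 0]
  have hb : r b = ![0, 1] := by
    simpa [Fintype.linearCombination_apply] using LinearMap.congr_fun hr ![0, 1]
  refine ⟨LinearMap.toContinuousLinearMap (LinearMap.proj 0 ∘ₗ r),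
    LinearMap.toContinuousLinearMap (LinearMap.proj 1 ∘ₗ r), ?_⟩
  simp [ha, hb]

variable {EB HB B F : Type*} {E : B → Type*} [NormedAddCommGroup EB] [NormedSpace ℝ EB]
  [TopologicalSpace HB] {I : ModelWithCorners ℝ EB HB} [TopologicalSpace B] [ChartedSpace HB B]
  [NormedAddCommGroup F] [NormedSpace ℂ F] [FiniteDimensional ℂ F]
  [∀ x, AddCommGroup (E x)] [∀ x, Module ℂ (E x)] [∀ x, TopologicalSpace (E x)]
  [TopologicalSpace (TotalSpace F E)] [FiberBundle F E] [VectorBundle ℂ F E]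
  {n : ℕ∞} [ContMDiffVectorBundle n F E I] {a b : ∀ x, E x}

theorem linearIndependent_trivialization_iff (e : Trivialization F (π F E))
    [MemTrivializationAtlas e] {x : B} (hx : x ∈ e.baseSet) (v w : E x) :
    LinearIndependent ℂ ![(e ⟨x, v⟩).2, (e ⟨x, w⟩).2] ↔ LinearIndependent ℂ ![v, w] := by
  have h := LinearMap.linearIndependent_iff (v := ![v, w])
    ((e.linearEquivAt ℂ x hx : E x ≃ₗ[ℂ] F) : E x →ₗ[ℂ] F) (LinearEquiv.ker _)
  rw [← h]
  congr! 1
  ext i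
  fin_cases i <;> rfl

theorem exists_local_functional
    (ha : ContMDiff I (I.prod 𝓘(ℝ, F)) n (fun x => TotalSpace.mk' F x (a x)))
    (hb : ContMDiff I (I.prod 𝓘(ℝ, F)) n (fun x => TotalSpace.mk' F x (b x)))
    (hab : ∀ x, LinearIndependent ℂ ![a x, b x]) (x₀ : B) :
    ∃ U : Set B, IsOpen U ∧ x₀ ∈ U ∧ ∃ p : ∀ x, E x →ₗ[ℂ] ℂ,
      ContMDiffOn (I.prod 𝓘(ℝ, F)) 𝓘(ℝ, ℂ) n (fun v : TotalSpace F E => p v.proj v.2)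
        (π F E ⁻¹' U) ∧ ∀ x ∈ U, p x (a x) = 1 ∧ p x (b x) = 0 := by
  set e := trivializationAt F E x₀
  have hx₀ : x₀ ∈ e.baseSet := mem_baseSet_trivializationAt F E x₀
  have ha' := e.contMDiffOn_section_baseSet_iff.1 ha.contMDiffOn
  have hb' := e.contMDiffOn_section_baseSet_iff.1 hb.contMDiffOn
  set u₁ : B → F := fun x => (e ⟨x, a x⟩).2
  set u₂ : B → F := fun x => (e ⟨x, b x⟩).2
  obtain ⟨A, C, hA₁, hA₂, hC₁, hC₂⟩ := exists_dual_pair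
    ((linearIndependent_trivialization_iff e hx₀ (a x₀) (b x₀)).2 (hab x₀))
  -- The determinant of the pair of sections in the coordinates `(A, C)`. It equals `1` at `x₀`, and
  -- the functional `p` below is Cramer's formula for the coefficient of `a`.
  let D : B → ℂ := fun x => A (u₁ x) * C (u₂ x) - C (u₁ x) * A (u₂ x)
  have hD : ContMDiffOn I 𝓘(ℝ, ℂ) n D e.baseSet :=
    (contMDiffOn_complex_mul (contMDiffOn_complexDual A ha') (contMDiffOn_complexDual C hb')).sub
      (contMDiffOn_complex_mul (contMDiffOn_complexDual C ha') (contMDiffOn_complexDual A hb'))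
  let U : Set B := e.baseSet ∩ D ⁻¹' {0}ᶜ
  have hU : IsOpen U := hD.continuousOn.isOpen_inter_preimage e.open_baseSet isOpen_compl_singleton
  let p (x : B) : E x →ₗ[ℂ] ℂ := (D x)⁻¹ •
    (C (u₂ x) • ((A : F →ₗ[ℂ] ℂ) ∘ₗ e.linearMapAt ℂ x) -
      A (u₂ x) • ((C : F →ₗ[ℂ] ℂ) ∘ₗ e.linearMapAt ℂ x))
  have hp (x : B) (hx : x ∈ e.baseSet) (v : E x) : p x v =
      (D x)⁻¹ * (C (u₂ x) * A (e ⟨x, v⟩).2 - A (u₂ x) * C (e ⟨x, v⟩).2) := by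
    simp [p, e.coe_linearMapAt_of_mem hx]
  refine ⟨U, hU, ⟨hx₀, ?_⟩, p, ?_, ?_⟩
  · simp only [D, mem_preimage, mem_compl_iff, mem_singleton_iff]
    change A (u₁ x₀) = 1 at hA₁
    change A (u₂ x₀) = 0 at hA₂
    change C (u₂ x₀) = 1 at hC₂
    simp [hA₁, hA₂, hC₂]
  · have hproj : ContMDiffOn (I.prod 𝓘(ℝ, F)) I n (π F E) (π F E ⁻¹' U) := contMDiffOn_proj E
    have hmaps : MapsTo (π F E) (π F E ⁻¹' U) e.baseSet := fun v hv => hv.1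
    have he : ContMDiffOn (I.prod 𝓘(ℝ, F)) 𝓘(ℝ, F) n (fun v : TotalSpace F E => (e v).2)
        (π F E ⁻¹' U) :=
      ((e.contMDiffOn_iff (IB := I) (n := n) (s := π F E ⁻¹' U) (f := id)
        (fun v hv => e.mem_source.2 hv.1)).1 contMDiffOn_id).2
    have hD' : ContMDiffOn (I.prod 𝓘(ℝ, F)) 𝓘(ℝ, ℂ) n (fun v : TotalSpace F E => (D v.proj)⁻¹)
        (π F E ⁻¹' U) := by
      intro v hv
      have h₁ : ContDiffAt ℝ n (fun z : ℂ => z⁻¹) (D v.proj) := contDiffAt_inv ℝ hv.2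
      exact h₁.contMDiffAt.comp_contMDiffWithinAt v ((hD.comp hproj hmaps) v hv)
    have h₂ := hb'.comp hproj hmaps
    exact (contMDiffOn_complex_mul hD' ((contMDiffOn_complex_mul (contMDiffOn_complexDual C h₂)
      (contMDiffOn_complexDual A he)).sub (contMDiffOn_complex_mul (contMDiffOn_complexDual A h₂)
      (contMDiffOn_complexDual C he)))).congr fun v hv => hp v.proj hv.1 v.2
  · intro x hx
    have hDx : D x ≠ 0 := hx.2
    rw [hp x hx.1, hp x hx.1]
    constructor
    · rw [inv_mul_eq_one₀ hDx]
      simp only [D, u₁, u₂]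
      ring
    · simp only [u₂]
      ring

/-- The conditions on `p` are affine, so local solutions can be averaged with a smooth partition of
unity. -/
theorem exists_functional [FiniteDimensional ℝ EB] [T2Space B] [SigmaCompactSpace B]
    [IsManifold I ∞ B]
    (ha : ContMDiff I (I.prod 𝓘(ℝ, F)) n (fun x => TotalSpace.mk' F x (a x)))
    (hb : ContMDiff I (I.prod 𝓘(ℝ, F)) n (fun x => TotalSpace.mk' F x (b x)))
    (hab : ∀ x, LinearIndependent ℂ ![a x, b x]) :
    ∃ p : ∀ x, E x →ₗ[ℂ] ℂ,
      ContMDiff (I.prod 𝓘(ℝ, F)) 𝓘(ℝ, ℂ) n (fun v : TotalSpace F E => p v.proj v.2) ∧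
      ∀ x, p x (a x) = 1 ∧ p x (b x) = 0 := by
  choose U hU hxU p hp hpab using exists_local_functional (I := I) ha hb hab
  obtain ⟨ρ, hρ⟩ := SmoothPartitionOfUnity.exists_isSubordinate I isClosed_univ U hU
    fun x _ => mem_iUnion.2 ⟨x, hxU x⟩
  have hfin (x : B) : {j | ρ j x • p j x ≠ 0}.Finite :=
    (ρ.locallyFinite.point_finite x).subset fun j hj h => hj (by rw [h, zero_smul])
  have happly (x : B) (v : E x) :
      (∑ᶠ j, ρ j x • p j x : E x →ₗ[ℂ] ℂ) v = ∑ᶠ j, ρ j x • p j x v := by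
    let ev : (E x →ₗ[ℂ] ℂ) →+ ℂ :=
      { toFun := fun f => f v, map_zero' := rfl, map_add' := fun _ _ => rfl }
    exact ev.map_finsum (hfin x)
  refine ⟨fun x => ∑ᶠ j, ρ j x • p j x, ?_, fun x => ?_⟩
  · simp only [happly]
    refine contMDiff_finsum (fun j v => ?_) ?_
    · by_cases hv : v.proj ∈ U j
      · have h₁ := (hp j).contMDiffAt
          (((hU j).preimage (FiberBundle.continuous_proj F E)).mem_nhds hv)
        have h₂ : ContMDiffAt (I.prod 𝓘(ℝ, F)) 𝓘(ℝ, ℝ) n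
            (fun v : TotalSpace F E => ρ j v.proj) v :=
          (((ρ j).contMDiff.of_le (mod_cast le_top)).comp (contMDiff_proj E)) v
        exact h₂.smul h₁
      · have hv' : v.proj ∉ tsupport (ρ j) := fun h => hv (hρ j h)
        refine (contMDiffAt_const (c := (0 : ℂ))).congr_of_eventuallyEq ?_
        have := (FiberBundle.continuous_proj F E).continuousAt.preimage_mem_nhds
          ((isClosed_tsupport (ρ j)).isOpen_compl.mem_nhds hv')
        filter_upwards [this] with z hz
        rw [image_eq_zero_of_notMem_tsupport hz, zero_smul]
    · refine (ρ.locallyFinite.preimage_continuous (FiberBundle.continuous_proj F E)).subset ?_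
      intro j v hv h
      exact hv (by simp only [h, zero_smul])
  · have hconv : Convex ℝ {f : E x →ₗ[ℂ] ℂ | f (a x) = 1 ∧ f (b x) = 0} := by
      rintro f ⟨hf₁, hf₂⟩ g ⟨hg₁, hg₂⟩ s t - - hst
      refine ⟨?_, ?_⟩
      · simp only [LinearMap.add_apply, LinearMap.smul_apply, hf₁, hg₁, Complex.real_smul, mul_one]
        exact_mod_cast hst
      · simp [hf₂, hg₂]
    refine hconv.finsum_mem (ρ.nonneg · x) (ρ.sum_eq_one (mem_univ x)) fun j hj => ?_
    exact hpab j x (hρ j (subset_closure hj))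

end Functional

/-! ### The action of the lift on sections -/

namespace QuaternionicBundle

section Sections

variable {EB HB : Type*} [NormedAddCommGroup EB] [NormedSpace ℝ EB] [TopologicalSpace HB]
  {I : ModelWithCorners ℝ EB HB} {J : Type u} [TopologicalSpace J] [ChartedSpace HB J]
  {n : ℕ∞} {ι : J → J} {F : Type w} [NormedAddCommGroup F] [NormedSpace ℂ F]
  (E : QuaternionicBundle.{u, v} I n ι F)

/-- The lift of the involution as a map of the total space. -/
def totalLift (v : TotalSpace F E.Fiber) : TotalSpace F E.Fiber :=
  ⟨ι v.proj, E.lift v.proj v.2⟩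

theorem contMDiff_totalLift : ContMDiff (I.prod 𝓘(ℝ, F)) (I.prod 𝓘(ℝ, F)) n E.totalLift :=
  E.contMDiff_lift

theorem totalLift_totalLift (v : TotalSpace F E.Fiber) :
    E.totalLift (E.totalLift v) = ⟨v.proj, -v.2⟩ :=
  E.lift_lift v.proj v.2

/-- The lift from the fiber over `y` to the fiber over `x = ι y`. -/
def liftTo {x y : J} (h : ι y = x) : E.Fiber y →ₛₗ[starRingEnd ℂ] E.Fiber x :=
  h ▸ E.lift y

/-- In the total space the transport along `h` disappears; equalities between fibers over points
that are only propositionally equal are therefore proved there. -/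
theorem mk_liftTo {x y : J} (h : ι y = x) (v : E.Fiber y) :
    (⟨x, E.liftTo h v⟩ : TotalSpace F E.Fiber) = E.totalLift ⟨y, v⟩ := by
  subst h
  rfl

variable {E} (hι : Involutive ι)

/-- The section `x ↦ lift (s (ι x))`. -/
def liftSection (s : ∀ x, E.Fiber x) (x : J) : E.Fiber x :=
  E.liftTo (hι x) (s (ι x))

theorem mk_liftSection (s : ∀ x, E.Fiber x) (x : J) :
    (⟨x, liftSection hι s x⟩ : TotalSpace F E.Fiber) = E.totalLift ⟨ι x, s (ι x)⟩ :=
  E.mk_liftTo _ _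

theorem contMDiff_liftSection {s : ∀ x, E.Fiber x} (hιs : ContMDiff I I n ι)
    (hs : ContMDiff I (I.prod 𝓘(ℝ, F)) n (fun x => TotalSpace.mk' F x (s x))) :
    ContMDiff I (I.prod 𝓘(ℝ, F)) n (fun x => TotalSpace.mk' F x (liftSection hι s x)) := by
  have h : (fun x => TotalSpace.mk' F x (liftSection hι s x)) =
      E.totalLift ∘ (fun x => TotalSpace.mk' F x (s x)) ∘ ι :=
    funext fun x => mk_liftSection hι s x
  rw [h]
  exact E.contMDiff_totalLift.comp (hs.comp hιs)

theorem liftSection_apply_ι (s : ∀ x, E.Fiber x) (x : J) :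
    liftSection hι s (ι x) = E.lift x (s x) := by
  refine TotalSpace.mk_injective (F := F) (ι x) ?_
  rw [mk_liftSection]
  exact congrArg (fun y => E.totalLift ⟨y, s y⟩) (hι x)

theorem liftSection_liftSection (s : ∀ x, E.Fiber x) (x : J) :
    liftSection hι (liftSection hι s) x = -s x := by
  refine TotalSpace.mk_injective (F := F) x ?_
  rw [mk_liftSection, liftSection_apply_ι]
  exact E.totalLift_totalLift ⟨x, s x⟩

theorem liftSection_add (s t : ∀ x, E.Fiber x) :
    liftSection hι (s + t) = liftSection hι s + liftSection hι t :=
  funext fun x => map_add (E.liftTo (hι x)) _ _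

theorem liftSection_sub (s t : ∀ x, E.Fiber x) :
    liftSection hι (s - t) = liftSection hι s - liftSection hι t :=
  funext fun x => map_sub (E.liftTo (hι x)) _ _

theorem liftSection_eq_zero {s : ∀ x, E.Fiber x} {x : J} (h : s (ι x) = 0) :
    liftSection hι s x = 0 := by
  rw [liftSection, h, map_zero]

theorem lift_liftSection (s : ∀ x, E.Fiber x) (x : J) :
    E.lift x (liftSection hι s x) = -s (ι x) := by
  rw [← liftSection_apply_ι hι, liftSection_liftSection]

/-- The section `s` and its image under the lift are independent at `x`. -/
def IsIndependentAt (s : ∀ x, E.Fiber x) (x : J) : Prop :=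
  LinearIndependent ℂ ![s x, liftSection hι s x]

variable {hι}

/-- The lift sends a relation `a s + b σ s = 0` at `ι x` to the relation `conj a σ s - conj b s = 0`
at `x`. -/
theorem IsIndependentAt.apply_ι {s : ∀ x, E.Fiber x} {x : J} (h : IsIndependentAt hι s x) :
    IsIndependentAt hι s (ι x) := by
  unfold IsIndependentAt at *
  rw [LinearIndependent.pair_iff] at *
  intro a b hab
  have h₁ := congrArg (E.liftTo (hι x)) hab
  rw [map_add, LinearMap.map_smulₛₗ, LinearMap.map_smulₛₗ, map_zero] at h₁
  have h₂ : E.liftTo (hι x) (liftSection hι s (ι x)) = -s x := liftSection_liftSection hι s x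
  have h₃ : E.liftTo (hι x) (s (ι x)) = liftSection hι s x := rfl
  rw [h₂, h₃, smul_neg, ← neg_smul, add_comm] at h₁
  obtain ⟨hb, ha⟩ := h _ _ h₁
  simpa [and_comm] using And.intro hb ha

theorem isIndependentAt_ι_iff {s : ∀ x, E.Fiber x} {x : J} :
    IsIndependentAt hι s (ι x) ↔ IsIndependentAt hι s x := by
  refine ⟨fun h => ?_, fun h => h.apply_ι⟩
  have := h.apply_ι
  rwa [hι x] at this

/-- If `σ s = c s` at a fixed point, applying the lift again gives `-s = |c|² s`, which is
impossible for `s x ≠ 0`. -/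
theorem isIndependentAt_of_fixed {s : ∀ x, E.Fiber x} {x : J} (hx : ι x = x) (hs : s x ≠ 0) :
    IsIndependentAt hι s x := by
  have h₁ : liftSection hι s x = E.liftTo hx (s x) := by
    refine TotalSpace.mk_injective (F := F) x ?_
    rw [mk_liftSection, mk_liftTo]
    exact congrArg (fun y => E.totalLift ⟨y, s y⟩) hx
  have h₂ : E.liftTo hx (E.liftTo hx (s x)) = -s x := by
    refine TotalSpace.mk_injective (F := F) x ?_
    rw [mk_liftTo, mk_liftTo, totalLift_totalLift]
  rw [IsIndependentAt, LinearIndependent.pair_iff' hs]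
  intro c hc
  rw [h₁] at hc
  rw [← hc, LinearMap.map_smulₛₗ, ← hc, smul_smul, ← sub_eq_zero, sub_neg_eq_add] at h₂
  have h₃ : ((starRingEnd ℂ) c * c + 1) • s x = 0 := by rw [add_smul, one_smul, h₂]
  rcases smul_eq_zero.1 h₃ with h | h
  · rw [← Complex.normSq_eq_conj_mul_self] at h
    have h₄ : Complex.normSq c + 1 = 0 := by exact_mod_cast h
    linarith [Complex.normSq_nonneg c]
  · exact hs h

end Sections

/-! ### Splitting off a trivial line -/

section Splitting

variable {EB HB : Type*} [NormedAddCommGroup EB] [NormedSpace ℝ EB] [TopologicalSpace HB]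
  {I : ModelWithCorners ℝ EB HB} {J : Type u} [TopologicalSpace J] [ChartedSpace HB J]
  {n : ℕ∞} {ι : J → J} {F : Type w} [NormedAddCommGroup F] [NormedSpace ℂ F]
  {E : QuaternionicBundle.{u, v} I n ι F} (hι : Involutive ι)

/-- The map from the trivial quaternionic line defined by a section. -/
noncomputable def lineMap (s : ∀ x, E.Fiber x) (x : J) : QuaternionLine →ₗ[ℂ] E.Fiber x where
  toFun h := h 0 • s x + h 1 • liftSection hι s x
  map_add' h h' := by simp only [PiLp.add_apply, add_smul]; abel
  map_smul' c h := by simp [smul_smul]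

theorem lineMap_apply (s : ∀ x, E.Fiber x) (x : J) (h : QuaternionLine) :
    lineMap hι s x h = h 0 • s x + h 1 • liftSection hι s x :=
  rfl

theorem lineMap_mulJ (s : ∀ x, E.Fiber x) (x : J) (h : QuaternionLine) :
    lineMap hι s (ι x) (mulJ h) = E.lift x (lineMap hι s x h) := by
  rw [lineMap_apply, lineMap_apply, map_add, LinearMap.map_smulₛₗ, LinearMap.map_smulₛₗ,
    lift_liftSection, liftSection_apply_ι]
  simp [mulJ, add_comm]

/-- The equivariant map to the trivial quaternionic line defined by a functional. -/
noncomputable def toLine (p : ∀ x, E.Fiber x →ₗ[ℂ] ℂ) (x : J) :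
    E.Fiber x →ₗ[ℂ] QuaternionLine where
  -- Equivariance forces the second coordinate: the first coordinate of `mulJ w` is `-conj (w 1)`,
  -- and it must be the value of `p` on the lift of `v`.
  toFun v := !₂[p x v, -conj (p (ι x) (E.lift x v))]
  map_add' v w := by ext i; fin_cases i <;> simp [add_comm]
  map_smul' c v := by ext i; fin_cases i <;> simp [LinearMap.map_smulₛₗ]

theorem toLine_apply (p : ∀ x, E.Fiber x →ₗ[ℂ] ℂ) (x : J) (v : E.Fiber x) :
    toLine p x v = !₂[p x v, -conj (p (ι x) (E.lift x v))] :=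
  rfl

theorem toLine_lift (p : ∀ x, E.Fiber x →ₗ[ℂ] ℂ) (x : J) (v : E.Fiber x) :
    toLine p (ι x) (E.lift x v) = mulJ (toLine p x v) := by
  have h : p (ι (ι x)) (E.lift (ι x) (E.lift x v)) = -p x v :=
    (congrArg (fun z : TotalSpace F E.Fiber => p z.proj z.2) (E.lift_lift x v)).trans
      (map_neg (p x) v)
  ext i
  fin_cases i <;> simp [toLine_apply, mulJ, h]

theorem contMDiff_toLine {p : ∀ x, E.Fiber x →ₗ[ℂ] ℂ}
    (hp : ContMDiff (I.prod 𝓘(ℝ, F)) 𝓘(ℝ, ℂ) n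
      (fun v : TotalSpace F E.Fiber => p v.proj v.2)) :
    ContMDiff (I.prod 𝓘(ℝ, F)) 𝓘(ℝ, QuaternionLine) n
      (fun v : TotalSpace F E.Fiber => toLine p v.proj v.2) := by
  let L : ℂ × ℂ →ₗ[ℝ] QuaternionLine :=
    { toFun := fun z => !₂[z.1, -conj z.2]
      map_add' := fun z w => by ext i; fin_cases i <;> simp [add_comm]
      map_smul' := fun c z => by ext i; fin_cases i <;> simp }
  exact (LinearMap.toContinuousLinearMap L).contMDiff.comp
    (hp.prodMk_space (hp.comp E.contMDiff_lift))

/-- The first coordinate uses the conditions on `p` at `x`, the second those at `ι x`, where the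
lift turns `s` into `σ s` and `σ s` into `-s`. -/
theorem toLine_lineMap {p : ∀ x, E.Fiber x →ₗ[ℂ] ℂ} {s : ∀ x, E.Fiber x}
    (hp : ∀ x, p x (s x) = 1 ∧ p x (liftSection hι s x) = 0) (x : J) (h : QuaternionLine) :
    toLine p x (lineMap hι s x h) = h := by
  ext i
  fin_cases i
  · simp [toLine_apply, lineMap_apply, (hp x).1, (hp x).2]
  · simp [toLine_apply, lineMap_apply, LinearMap.map_smulₛₗ,
      ← liftSection_apply_ι hι, liftSection_liftSection, (hp (ι x)).1, (hp (ι x)).2]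

theorem contMDiff_lineMap {s : ∀ x, E.Fiber x} (hιs : ContMDiff I I n ι)
    (hs : ContMDiff I (I.prod 𝓘(ℝ, F)) n (fun x => TotalSpace.mk' F x (s x)))
    {EM HM M : Type*} [NormedAddCommGroup EM] [NormedSpace ℝ EM]
    [TopologicalSpace HM] {IM : ModelWithCorners ℝ EM HM} [TopologicalSpace M] [ChartedSpace HM M]
    {b : M → J} (hb : ContMDiff IM I n b) {h : M → QuaternionLine}
    (hh : ContMDiff IM 𝓘(ℝ, QuaternionLine) n h) :
    ContMDiff IM (I.prod 𝓘(ℝ, F)) n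
      (fun y => TotalSpace.mk' F (b y) (lineMap hι s (b y) (h y))) := by
  have hcoord (i : Fin 2) : ContMDiff IM 𝓘(ℝ, ℂ) n (fun y => h y i) :=
    (((EuclideanSpace.proj i : QuaternionLine →L[ℂ] ℂ).restrictScalars ℝ).contMDiff).comp hh
  exact contMDiff_mk_add (contMDiff_mk_smul (hcoord 0) (hs.comp hb))
    (contMDiff_mk_smul (hcoord 1) ((contMDiff_liftSection hι hιs hs).comp hb))

section KernelQuaternionic

variable [FiniteDimensional ℂ F] {F' : Type*} [NormedAddCommGroup F'] [NormedSpace ℂ F']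
  [FiniteDimensional ℂ F'] {p : ∀ x, E.Fiber x →ₗ[ℂ] ℂ} {q : J → F →L[ℂ] F'}

/-- The lift restricted to the kernel of `toLine p`. -/
noncomputable def kernelLift (p : ∀ x, E.Fiber x →ₗ[ℂ] ℂ) (q : J → F →L[ℂ] F') (x : J) :
    KernelFiber (toLine p) q x →ₛₗ[starRingEnd ℂ] KernelFiber (toLine p) q (ι x) where
  toFun v := KernelFiber.mk q (E.lift x (KernelFiber.incl (toLine p) q x v))
    (by rw [toLine_lift, KernelFiber.apply_incl, map_zero])
  map_add' v w := KernelFiber.incl_injective (ι x) (by simp)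
  map_smul' c v := KernelFiber.incl_injective (ι x) (by simp [LinearMap.map_smulₛₗ])

theorem totalSpace_incl_injective : Injective
    (fun v : TotalSpace F' (KernelFiber (toLine p) q) =>
      (⟨v.proj, KernelFiber.incl (toLine p) q v.proj v.2⟩ : TotalSpace F E.Fiber)) := by
  rintro ⟨x, v⟩ ⟨y, w⟩ h
  obtain rfl : x = y := congrArg TotalSpace.proj h
  exact congrArg (TotalSpace.mk x)
    (KernelFiber.incl_injective x (TotalSpace.mk_injective (F := F) x h))

/-- The kernel of `toLine p` as a quaternionic bundle. -/
noncomputable def kernel (hp : ContMDiff (I.prod 𝓘(ℝ, F)) 𝓘(ℝ, ℂ) n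
      (fun v : TotalSpace F E.Fiber => p v.proj v.2))
    (hq : ∀ x, x ∈ kernelBaseSet (toLine p) (trivializationAt F E.Fiber x) (q x)) :
    QuaternionicBundle.{u, v} I n ι F' :=
  letI := (kernelPrebundle (contMDiff_toLine hp) hq).totalSpaceTopology
  letI := (kernelPrebundle (contMDiff_toLine hp) hq).toFiberBundle
  letI := (kernelPrebundle (contMDiff_toLine hp) hq).toVectorBundle
  letI := kernelPrebundle_contMDiffVectorBundle (contMDiff_toLine hp) hq
  { Fiber := KernelFiber (toLine p) q
    lift := kernelLift p q
    contMDiff_lift := contMDiff_kernel_of_incl (contMDiff_toLine hp) hq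
      (E.contMDiff_lift.comp (contMDiff_kernel_incl (contMDiff_toLine hp) hq))
    lift_lift := fun x v => totalSpace_incl_injective
      ((E.lift_lift x _).trans (congrArg (TotalSpace.mk x) (map_neg _ v).symm)) }

/-- The fiberwise decomposition defined by a section and a dual functional. -/
noncomputable def splitEquiv {s : ∀ x, E.Fiber x} (q : J → F →L[ℂ] F')
    (hps : ∀ x, p x (s x) = 1 ∧ p x (liftSection hι s x) = 0) (x : J) :
    E.Fiber x ≃ₗ[ℂ] QuaternionLine × KernelFiber (toLine p) q x where
  toFun v := (toLine p x v, KernelFiber.mk q (v - lineMap hι s x (toLine p x v))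
    (by rw [map_sub, toLine_lineMap hι hps, sub_self]))
  map_add' v w := Prod.ext (map_add _ v w) (KernelFiber.incl_injective x
    (by simp only [KernelFiber.incl_mk, Prod.snd_add, map_add]; abel))
  map_smul' c v := Prod.ext (map_smul _ c v) (KernelFiber.incl_injective x
    (by simp only [KernelFiber.incl_mk, Prod.smul_snd, map_smul, smul_sub, RingHom.id_apply]))
  invFun z := lineMap hι s x z.1 + KernelFiber.incl (toLine p) q x z.2
  left_inv v := by simp
  right_inv z := by
    have h : toLine p x (lineMap hι s x z.1 + KernelFiber.incl (toLine p) q x z.2) = z.1 := by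
      rw [map_add, toLine_lineMap hι hps, KernelFiber.apply_incl, add_zero]
    refine Prod.ext h (KernelFiber.incl_injective x ?_)
    rw [KernelFiber.incl_mk, h, add_sub_cancel_left]

/-- An equivariant map with an equivariant section splits its source as the image of the section
plus the kernel; it remains to check regularity of both directions. -/
theorem nonempty_iso_directSum_kernel {s : ∀ x, E.Fiber x} (hιs : ContMDiff I I n ι)
    (hs : ContMDiff I (I.prod 𝓘(ℝ, F)) n (fun x => TotalSpace.mk' F x (s x)))
    (hp : ContMDiff (I.prod 𝓘(ℝ, F)) 𝓘(ℝ, ℂ) n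
      (fun v : TotalSpace F E.Fiber => p v.proj v.2))
    (hps : ∀ x, p x (s x) = 1 ∧ p x (liftSection hι s x) = 0)
    (hq : ∀ x, x ∈ kernelBaseSet (toLine p) (trivializationAt F E.Fiber x) (q x)) :
    Nonempty (E.Iso ((trivialLine I n ι hιs hι).directSum (kernel hp hq))) := by
  let _ := (kernelPrebundle (contMDiff_toLine hp) hq).totalSpaceTopology
  let _ := (kernelPrebundle (contMDiff_toLine hp) hq).toFiberBundle
  let _ := (kernelPrebundle (contMDiff_toLine hp) hq).toVectorBundle
  refine ⟨⟨splitEquiv hι q hps, ?_, ?_, ?_⟩⟩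
  · refine contMDiff_totalSpace_prod_iff.2 ⟨?_, ?_⟩
    · exact fun v => contMDiffAt_totalSpace.2 ⟨contMDiff_proj _ v, contMDiff_toLine hp v⟩
    · refine contMDiff_kernel_of_incl (contMDiff_toLine hp) hq ?_
      exact contMDiff_mk_sub contMDiff_id
        (contMDiff_lineMap hι hιs hs (contMDiff_proj _) (contMDiff_toLine hp))
  · have h := contMDiff_totalSpace_prod_iff.1
      (contMDiff_id (I := I.prod 𝓘(ℝ, QuaternionLine × F')) (n := (n : WithTop ℕ∞))
        (M := TotalSpace (QuaternionLine × F')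
          (Bundle.Trivial J QuaternionLine ×ᵇ KernelFiber (toLine p) q)))
    have h₁ : ContMDiff (I.prod 𝓘(ℝ, QuaternionLine × F')) 𝓘(ℝ, QuaternionLine) n
        (fun z : TotalSpace (QuaternionLine × F')
          (Bundle.Trivial J QuaternionLine ×ᵇ KernelFiber (toLine p) q) => z.2.1) :=
      fun z => (contMDiffAt_totalSpace.1 (h.1 z)).2
    exact contMDiff_mk_add (contMDiff_lineMap hι hιs hs (contMDiff_proj _) h₁)
      ((contMDiff_kernel_incl (contMDiff_toLine hp) hq).comp h.2)
  · intro x v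
    refine Prod.ext (toLine_lift p x v) (KernelFiber.incl_injective (P := toLine p) (q := q) (ι x) ?_)
    change E.lift x v - lineMap hι s (ι x) (toLine p (ι x) (E.lift x v)) =
      E.lift x (v - lineMap hι s x (toLine p x v))
    rw [toLine_lift, lineMap_mulJ, map_sub]

end KernelQuaternionic

theorem exists_iso_directSum_of_section [FiniteDimensional ℂ F] [FiniteDimensional ℝ EB]
    [T2Space J] [SigmaCompactSpace J] [IsManifold I ∞ J]
    (F' : Type*) [NormedAddCommGroup F'] [NormedSpace ℂ F'] [FiniteDimensional ℂ F']
    (hdim : 2 + Module.finrank ℂ F' = Module.finrank ℂ F) (hιs : ContMDiff I I n ι)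
    {s : ∀ x, E.Fiber x}
    (hs : ContMDiff I (I.prod 𝓘(ℝ, F)) n (fun x => TotalSpace.mk' F x (s x)))
    (hind : ∀ x, IsIndependentAt hι s x) :
    ∃ E' : QuaternionicBundle.{u, v} I n ι F',
      Nonempty (E.Iso ((trivialLine I n ι hιs hι).directSum E')) := by
  obtain ⟨p, hp, hps⟩ := exists_functional (I := I) hs (contMDiff_liftSection hι hιs hs) hind
  have hsurj (x : J) : Surjective (toLine p x) :=
    fun h => ⟨_, toLine_lineMap hι hps x h⟩
  choose q hq using exists_mem_kernelBaseSet (F := F) (F' := F') hsurj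
    (by rw [finrank_euclideanSpace_fin, hdim])
  exact ⟨kernel hp hq, nonempty_iso_directSum_kernel hι hιs hs hp hps hq⟩

end Splitting

end QuaternionicBundle

/-! ### General position -/

section GeneralPosition

variable {V F : Type*} [NormedAddCommGroup V] [NormedSpace ℝ V] [FiniteDimensional ℝ V]
  [NormedAddCommGroup F] [NormedSpace ℂ F] [FiniteDimensional ℂ F]

theorem isOpen_setOf_linearIndependent_pair :
    IsOpen {z : F × F | LinearIndependent ℂ ![z.1, z.2]} := by
  have h : Continuous fun z : F × F => (![z.1, z.2] : Fin 2 → F) := by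
    refine continuous_pi fun i => ?_
    fin_cases i
    · exact continuous_fst
    · exact continuous_snd
  exact (isOpen_setOfPred_linearIndependent (𝕜 := ℂ) (E := F) (ι := Fin 2)).preimage h

/-- A `C^1` map on a convex set does not raise Hausdorff dimension. This is the only transversality
input needed. -/
theorem dimH_image_le_finrank {W X : Type*} [NormedAddCommGroup W] [NormedSpace ℝ W]
    [FiniteDimensional ℝ W] [NormedAddCommGroup X] [NormedSpace ℝ X]
    {f : W → X} {s : Set W} (hf : ContDiffOn ℝ 1 f s) (hs : Convex ℝ s) :
    dimH (f '' s) ≤ Module.finrank ℝ W :=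
  (hf.dimH_image_le hs subset_rfl).trans
    ((dimH_mono (subset_univ s)).trans_eq (Real.dimH_univ_eq_finrank W))

/-- A map of class `C^1` into pairs of vectors can be made to take values in linearly independent
pairs by adding a small constant, if the dimension of its domain is small. -/
theorem exists_linearIndependent_add {G : V → F × F} {s : Set V} (hG : ContDiffOn ℝ 1 G s)
    (hs : Convex ℝ s) (hdim : Module.finrank ℝ V + 2 < Module.finrank ℝ F) {ε : ℝ} (hε : 0 < ε) :
    ∃ c : F × F, ‖c‖ < ε ∧ ∀ y ∈ s, LinearIndependent ℂ ![(G y + c).1, (G y + c).2] := by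
  -- A dependent pair is `(w, t w)` or `(0, w)`. So `f₁` and `f₂` together cover all `c` for which
  -- `G y + c` is dependent for some `y`. Their domains have real dimension at most `dim V + 2 + dim
  -- F`, less than `2 dim F`, so the good `c` are dense.
  let f₁ : V × ℂ × F → F × F := fun z => (z.2.2, z.2.1 • z.2.2) - G z.1
  let f₂ : V × F → F × F := fun z => (0, z.2) - G z.1
  have h₁ : ContDiffOn ℝ 1 f₁ (s ×ˢ univ) := by
    refine ContDiffOn.sub (ContDiff.contDiffOn ?_) (hG.comp contDiffOn_fst fun z hz => hz.1)
    have hsmul : ContDiff ℝ 1 fun z : V × ℂ × F => z.2.1 • z.2.2 :=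
      ((isBoundedBilinearMap_smul (𝕜 := ℝ) (A := ℂ) (E := F)).contDiff).comp contDiff_snd
    exact (contDiff_snd.comp contDiff_snd).prodMk hsmul
  have h₂ : ContDiffOn ℝ 1 f₂ (s ×ˢ univ) :=
    ContDiffOn.sub (contDiff_const.prodMk contDiff_snd).contDiffOn
      (hG.comp contDiffOn_fst fun z hz => hz.1)
  have hdimH : dimH (f₁ '' (s ×ˢ univ) ∪ f₂ '' (s ×ˢ univ)) < Module.finrank ℝ (F × F) := by
    rw [dimH_union, max_lt_iff]
    constructor
    · refine (dimH_image_le_finrank h₁ (hs.prod convex_univ)).trans_lt ?_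
      rw [Module.finrank_prod, Module.finrank_prod, Module.finrank_prod, Complex.finrank_real_complex]
      exact_mod_cast (by omega)
    · refine (dimH_image_le_finrank h₂ (hs.prod convex_univ)).trans_lt ?_
      rw [Module.finrank_prod, Module.finrank_prod]
      exact_mod_cast (by omega)
  obtain ⟨c, hc, hcε⟩ := (dense_compl_of_dimH_lt_finrank hdimH).exists_dist_lt 0 hε
  refine ⟨c, by simpa using hcε, fun y hy => ?_⟩
  by_contra hdep
  refine hc ?_
  by_cases h0 : (G y + c).1 = 0
  · refine Or.inr ⟨(y, (G y + c).2), ⟨hy, mem_univ _⟩, ?_⟩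
    simp only [f₂]
    rw [← h0, Prod.mk.eta, add_sub_cancel_left]
  · rw [LinearIndependent.pair_iff' h0] at hdep
    push Not at hdep
    obtain ⟨t, ht⟩ := hdep
    refine Or.inl ⟨(y, t, (G y + c).1), ⟨hy, mem_univ _⟩, ?_⟩
    simp only [f₁]
    rw [ht, Prod.mk.eta, add_sub_cancel_left]

end GeneralPosition

/-! ### Perturbation of sections -/

section CutOff

variable {EB HB B F : Type*} {E : B → Type*} [NormedAddCommGroup EB] [NormedSpace ℝ EB]
  [TopologicalSpace HB] {I : ModelWithCorners ℝ EB HB} [TopologicalSpace B] [ChartedSpace HB B]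
  [NormedAddCommGroup F] [NormedSpace ℂ F]
  [∀ x, AddCommGroup (E x)] [∀ x, Module ℂ (E x)] [∀ x, TopologicalSpace (E x)]
  [TopologicalSpace (TotalSpace F E)] [FiberBundle F E] [VectorBundle ℂ F E]
  {n : WithTop ℕ∞} [ContMDiffVectorBundle n F E I]

/-- Adding `α` to `s` moves its coordinate towards `a`, and reaches `a` exactly where `ψ = 1`. The
inner factor `ψ` is there because `a` will approximate `ψ` times the coordinate of `s`, a function
defined on all of `B`. -/
theorem exists_section_cutOff (e : Trivialization F (π F E)) [MemTrivializationAtlas e]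
    {ψ : B → ℝ} (hψ : ContMDiff I 𝓘(ℝ, ℝ) n ψ) (hψe : tsupport ψ ⊆ e.baseSet) {a : B → F}
    (ha : ContMDiff I 𝓘(ℝ, F) n a) {s : ∀ x, E x}
    (hs : ContMDiff I (I.prod 𝓘(ℝ, F)) n (fun x => TotalSpace.mk' F x (s x))) :
    ∃ α : ∀ x, E x, ContMDiff I (I.prod 𝓘(ℝ, F)) n (fun x => TotalSpace.mk' F x (α x)) ∧
      (∀ x, ψ x = 0 → α x = 0) ∧
      ∀ x ∈ e.baseSet, (e ⟨x, α x⟩).2 = ψ x • (a x - ψ x • (e ⟨x, s x⟩).2) := by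
  let r : ∀ x, E x := (fun x => e.symm x (a x)) - ψ • s
  have hr : ContMDiffOn I (I.prod 𝓘(ℝ, F)) n (fun x => TotalSpace.mk' F x (r x)) e.baseSet :=
    ContMDiffOn.sub_section (contMDiffOn_symm_mk e e.open_baseSet subset_rfl ha.contMDiffOn)
      (hψ.smul_section hs).contMDiffOn
  refine ⟨ψ • r, ContMDiffOn.smul_section_of_tsupport hψ.contMDiffOn e.open_baseSet hψe hr,
    fun x hx => ?_, fun x hx => ?_⟩
  · simp [hx]
  · have hlin := e.linear ℝ hx
    have hr' : (e ⟨x, r x⟩).2 = a x - ψ x • (e ⟨x, s x⟩).2 := by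
      refine (hlin.map_sub _ _).trans ?_
      congr 1
      · rw [e.apply_mk_symm hx]
      · exact hlin.map_smul _ _
    rw [← hr']
    exact hlin.map_smul _ _

end CutOff

namespace QuaternionicBundle

variable {EB HB : Type*} [NormedAddCommGroup EB] [NormedSpace ℝ EB] [FiniteDimensional ℝ EB]
  [TopologicalSpace HB]
  {I : ModelWithCorners ℝ EB HB} {J : Type u} [TopologicalSpace J] [ChartedSpace HB J]
  [T2Space J] [SigmaCompactSpace J] [IsManifold I ∞ J]
  {n : ℕ∞} {ι : J → J} {F : Type w} [NormedAddCommGroup F] [NormedSpace ℂ F]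
  [FiniteDimensional ℂ F]
  {E : QuaternionicBundle.{u, v} I n ι F} (hι : Involutive ι)

/-- One step of the construction: independence is gained where `f = 1` and kept on the closed set
`A`, with changes only over the support of `f` and its image under `ι`. -/
theorem exists_perturbation (hιs : ContMDiff I I n ι)
    (hdim : Module.finrank ℝ EB + 2 < Module.finrank ℝ F) {s : ∀ x, E.Fiber x}
    (hs : ContMDiff I (I.prod 𝓘(ℝ, F)) n (fun x => TotalSpace.mk' F x (s x)))
    {A : Set J} (hA : IsClosed A) (hsA : ∀ x ∈ A, IsIndependentAt hι s x)
    {c : J} (f : SmoothBumpFunction I c)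
    (hfe : tsupport f ⊆ (trivializationAt F E.Fiber c).baseSet)
    (hfι : ∀ x ∈ tsupport f, ι x ∉ tsupport f) :
    ∃ s' : ∀ x, E.Fiber x,
      ContMDiff I (I.prod 𝓘(ℝ, F)) n (fun x => TotalSpace.mk' F x (s' x)) ∧
      (∀ x, f x = 0 → f (ι x) = 0 → s' x = s x) ∧
      (∀ x ∈ A, IsIndependentAt hι s' x) ∧ ∀ x, f x = 1 → IsIndependentAt hι s' x := by
  set e := trivializationAt F E.Fiber c
  have ht := contMDiff_liftSection hι hιs hs
  set t := liftSection hι s with ht_def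
  let u : J → F × F := fun x => ((e ⟨x, s x⟩).2, (e ⟨x, t x⟩).2)
  have hu : ContMDiffOn I 𝓘(ℝ, F × F) n u e.baseSet :=
    (e.contMDiffOn_section_baseSet_iff.1 hs.contMDiffOn).prodMk_space
      (e.contMDiffOn_section_baseSet_iff.1 ht.contMDiffOn)
  -- The change is also felt at points `x` of `A` with `ι x` in the support of `f`; these are
  -- treated at `ι x`, hence the symmetrized set.
  have hA' : IsClosed (A ∪ ι ⁻¹' A) := hA.union (hA.preimage hιs.continuous)
  have hC : IsCompact ((A ∪ ι ⁻¹' A) ∩ tsupport f) := f.hasCompactSupport.isCompact.inter_left hA'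
  -- Independence is an open condition, so by compactness every pair within `δ` of the values of `u`
  -- on this set is still independent.
  obtain ⟨δ, hδ, hδu⟩ := (hC.image_of_continuousOn
    (hu.continuousOn.mono (inter_subset_right.trans hfe))).exists_thickening_subset_open
    (isOpen_setOf_linearIndependent_pair (F := F)) (by
      rintro _ ⟨x, ⟨hxA, hxf⟩, rfl⟩
      refine (linearIndependent_trivialization_iff e (hfe hxf) (s x) (t x)).2 ?_
      rcases hxA with hx | hx
      · exact hsA x hx
      · exact isIndependentAt_ι_iff.1 (hsA (ι x) hx))
  have hw : Continuous fun x => f x • u x := by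
    refine continuous_of_tsupport fun x hx => ?_
    have hx' := hfe (closure_mono (support_smul_subset_left f u) hx)
    exact f.continuous.continuousAt.smul
      (hu.continuousOn.continuousAt (e.open_baseSet.mem_nhds hx'))
  -- For `n = 0` the pair `u` is merely continuous, while general position needs `C^1`; hence a
  -- smooth approximation first. The tolerance `δ` is shared equally between `g` and the constant
  -- `z₀`.
  obtain ⟨g, hg, -⟩ := hw.exists_contMDiff_approx I ⊤ (ε := fun _ => δ / 2) continuous_const
    fun _ => half_pos hδ
  have hG : ContDiffOn ℝ 1 (g ∘ (extChartAt I c).symm)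
      (Metric.ball (extChartAt I c c) f.rOut ∩ range I) :=
    ((g.contMDiff.comp_contMDiffOn (contMDiffOn_extChartAt_symm c)).contDiffOn.of_le
      (mod_cast le_top)).mono f.ball_subset
  obtain ⟨z₀, hz₀, hz₀'⟩ := exists_linearIndependent_add hG
    ((convex_ball _ _).inter I.convex_range) hdim (half_pos hδ)
  have hgz (x : J) (hx : f x ≠ 0) : LinearIndependent ℂ ![(g x + z₀).1, (g x + z₀).2] := by
    have hx' : x ∈ support f := hx
    rw [f.support_eq_symm_image] at hx'
    obtain ⟨y, hy, rfl⟩ := hx'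
    exact hz₀' y hy
  have hgs : ContMDiff I 𝓘(ℝ, F × F) n fun x => g x + z₀ :=
    (g.contMDiff.of_le (mod_cast le_top)).add contMDiff_const
  have hf : ContMDiff I 𝓘(ℝ, ℝ) n f := f.contMDiff.of_le (mod_cast le_top)
  obtain ⟨α, hα, hα₀, hαe⟩ := exists_section_cutOff (I := I) (n := n) e hf hfe
    (contDiff_fst.contMDiff.comp hgs : ContMDiff I 𝓘(ℝ, F) n fun x => (g x + z₀).1) hs
  obtain ⟨β, hβ, hβ₀, hβe⟩ := exists_section_cutOff (I := I) (n := n) e hf hfe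
    (contDiff_snd.contMDiff.comp hgs : ContMDiff I 𝓘(ℝ, F) n fun x => (g x + z₀).2) ht
  -- Since `σ² = -1`, the term `-σ β` contributes `+β` to `σ s'`. Over the support of `f` both `σ α`
  -- and `σ β` vanish, so there `s'` is `s + α` and `σ s'` is `t + β`.
  let s' : ∀ x, E.Fiber x := s + α - liftSection hι β
  have hls' (x : J) : liftSection hι s' x = t x + liftSection hι α x + β x := by
    have h : liftSection hι s' = t + liftSection hι α - liftSection hι (liftSection hι β) := by
      rw [liftSection_sub, liftSection_add]
    rw [h, Pi.sub_apply, liftSection_liftSection, sub_neg_eq_add]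
    rfl
  have hs'x (x : J) : s' x = s x + α x - liftSection hι β x := rfl
  -- The coordinates of `(s', σ s')` where `f ≠ 0`: at distance less than `δ` from `u`, and equal to
  -- the generic pair `g + z₀` where `f = 1`.
  let z : J → F × F := fun x => u x + f x • (g x + z₀ - f x • u x)
  have hz (x : J) (hx : f x ≠ 0) (hxz : LinearIndependent ℂ ![(z x).1, (z x).2]) :
      IsIndependentAt hι s' x := by
    have hxs : x ∈ tsupport f := subset_closure hx
    have hιx : f (ι x) = 0 := image_eq_zero_of_notMem_tsupport (hfι x hxs)
    have hxe := hfe hxs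
    rw [IsIndependentAt, ← linearIndependent_trivialization_iff e hxe, hls', hs'x,
      liftSection_eq_zero hι (hα₀ _ hιx), liftSection_eq_zero hι (hβ₀ _ hιx), add_zero, sub_zero]
    have h₁ : (e ⟨x, s x + α x⟩).2 = (z x).1 := by
      refine ((e.linear ℂ hxe).map_add _ _).trans ?_
      rw [hαe x hxe]
      rfl
    have h₂ : (e ⟨x, t x + β x⟩).2 = (z x).2 := by
      refine ((e.linear ℂ hxe).map_add _ _).trans ?_
      rw [hβe x hxe]
      rfl
    rwa [h₁, h₂]
  have hzA (x : J) (hx : f x ≠ 0) (hxA : x ∈ A ∪ ι ⁻¹' A) : IsIndependentAt hι s' x := by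
    refine hz x hx (hδu ?_)
    refine Metric.mem_thickening_iff.2 ⟨u x, ⟨x, ⟨hxA, subset_closure hx⟩, rfl⟩, ?_⟩
    rw [dist_eq_norm]
    simp only [z, add_sub_cancel_left]
    have h₁ : ‖g x - f x • u x‖ < δ / 2 := by
      have := hg x
      rwa [dist_eq_norm] at this
    have h₂ : ‖g x + z₀ - f x • u x‖ < δ := by
      rw [show g x + z₀ - f x • u x = (g x - f x • u x) + z₀ by abel]
      linarith [norm_add_le (g x - f x • u x) z₀]
    rw [norm_smul, Real.norm_of_nonneg f.nonneg]
    exact (mul_le_of_le_one_left (norm_nonneg _) f.le_one).trans_lt h₂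
  refine ⟨s', contMDiff_mk_sub (contMDiff_mk_add hs hα) (contMDiff_liftSection hι hιs hβ),
    fun x h₁ h₂ => ?_, fun x hx => ?_, fun x hx => ?_⟩
  · rw [hs'x, hα₀ x h₁, liftSection_eq_zero hι (hβ₀ _ h₂), add_zero, sub_zero]
  · by_cases h₁ : f x = 0
    · by_cases h₂ : f (ι x) = 0
      · rw [IsIndependentAt, hls', hs'x, hα₀ x h₁, hβ₀ x h₁,
          liftSection_eq_zero hι (hα₀ _ h₂), liftSection_eq_zero hι (hβ₀ _ h₂), add_zero, sub_zero,
          add_zero, add_zero]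
        exact hsA x hx
      · refine isIndependentAt_ι_iff.1 (hzA (ι x) h₂ (Or.inr ?_))
        rwa [mem_preimage, hι x]
    · exact hzA x h₁ (Or.inl hx)
  · have hx0 : f x ≠ 0 := by rw [hx]; exact one_ne_zero
    refine hz x hx0 ?_
    have : z x = g x + z₀ := by simp [z, hx]
    rw [this]
    exact hgz x hx0

end QuaternionicBundle

/-! ### Existence of an independent section -/

namespace QuaternionicBundle

variable {EB HB : Type*} [NormedAddCommGroup EB] [NormedSpace ℝ EB] [FiniteDimensional ℝ EB]
  [TopologicalSpace HB]
  {I : ModelWithCorners ℝ EB HB} {J : Type u} [TopologicalSpace J] [ChartedSpace HB J]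
  [T2Space J] [SigmaCompactSpace J] [IsManifold I ∞ J]
  {n : ℕ∞} {ι : J → J} {F : Type w} [NormedAddCommGroup F] [NormedSpace ℂ F]
  [FiniteDimensional ℂ F]
  {E : QuaternionicBundle.{u, v} I n ι F} (hι : Involutive ι)

theorem isOpen_setOf_isIndependentAt (hιs : ContMDiff I I n ι) {s : ∀ x, E.Fiber x}
    (hs : ContMDiff I (I.prod 𝓘(ℝ, F)) n (fun x => TotalSpace.mk' F x (s x))) :
    IsOpen {x | IsIndependentAt hι s x} := by
  refine isOpen_iff_mem_nhds.2 fun x hx => ?_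
  set e := trivializationAt F E.Fiber x
  have hxe : x ∈ e.baseSet := mem_baseSet_trivializationAt F E.Fiber x
  have hu : ContinuousOn
      (fun y => ((e ⟨y, s y⟩).2, (e ⟨y, liftSection hι s y⟩).2)) e.baseSet :=
    (e.contMDiffOn_section_baseSet_iff.1 hs.contMDiffOn).continuousOn.prodMk
      (e.contMDiffOn_section_baseSet_iff.1
        (contMDiff_liftSection hι hιs hs).contMDiffOn).continuousOn
  have h := (hu.continuousAt (e.open_baseSet.mem_nhds hxe)).preimage_mem_nhds
    ((isOpen_setOf_linearIndependent_pair (F := F)).mem_nhds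
      ((linearIndependent_trivialization_iff e hxe _ _).2 hx))
  filter_upwards [h, e.open_baseSet.mem_nhds hxe] with y hy hye
  exact (linearIndependent_trivialization_iff e hye _ _).1 hy

/-- Values are prescribed at fixed points only. Each constraint set is a point or a whole fiber,
hence convex. Near any `x` no fixed point other than `x` occurs, so the locally constant section
through `v₀` is a local solution. -/
theorem exists_section_ne_zero_of_fixed [Nontrivial F] (hιc : Continuous ι)
    (hfix : DiscreteTopology (fixedPoints ι)) :
    ∃ s : ∀ x, E.Fiber x, ContMDiff I (I.prod 𝓘(ℝ, F)) n (fun x => TotalSpace.mk' F x (s x)) ∧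
      ∀ x, ι x = x → s x ≠ 0 := by
  obtain ⟨v₀, hv₀⟩ := exists_ne (0 : F)
  let a (x : J) : E.Fiber x := (trivializationAt F E.Fiber x).symm x v₀
  have ha (x : J) : (trivializationAt F E.Fiber x ⟨x, a x⟩).2 = v₀ := by
    rw [Trivialization.apply_mk_symm _ (mem_baseSet_trivializationAt F E.Fiber x)]
  have ha₀ (x : J) : a x ≠ 0 := by
    intro h
    have h₁ := ha x
    rw [h] at h₁
    exact hv₀ (h₁.symm.trans (((trivializationAt F E.Fiber x).linear ℂ
      (mem_baseSet_trivializationAt F E.Fiber x)).map_zero))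
  have hiso (x : J) : ∀ᶠ y in 𝓝 x, ι y = y → y = x := by
    by_cases hx : ι x = x
    · have hx' : x ∈ fixedPoints ι := hx
      have h₁ : ({⟨x, hx'⟩} : Set (fixedPoints ι)) ∈ 𝓝 (⟨x, hx'⟩ : fixedPoints ι) := by simp
      rw [nhds_subtype_eq_comap, mem_comap] at h₁
      obtain ⟨U, hU, hUx⟩ := h₁
      filter_upwards [hU] with y hy hyy
      have hy' : (⟨y, hyy⟩ : fixedPoints ι) ∈ ({⟨x, hx'⟩} : Set (fixedPoints ι)) := hUx hy
      exact congrArg Subtype.val hy'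
    · filter_upwards [(isClosed_eq hιc continuous_id).isOpen_compl.mem_nhds hx] with y hy hyy
      exact absurd hyy hy
  have hconv (x : J) : Convex ℝ {v : E.Fiber x | ι x = x → v = a x} := by
    intro v hv w hw r t _ _ hrt hx
    rw [hv hx, hw hx, ← add_smul, hrt, one_smul]
  obtain ⟨s, hs⟩ := exists_contMDiffSection_forall_mem_convex_of_local I E.Fiber (n := n)
    (F_fiber := F) (fun x => {v | ι x = x → v = a x}) hconv fun x => by
      set e := trivializationAt F E.Fiber x
      have hxe : x ∈ e.baseSet := mem_baseSet_trivializationAt F E.Fiber x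
      refine ⟨e.baseSet ∩ {y | ι y = y → y = x},
        inter_mem (e.open_baseSet.mem_nhds hxe) (hiso x), fun y => e.symm y v₀,
        (contMDiffOn_symm_mk e e.open_baseSet subset_rfl contMDiffOn_const).mono inter_subset_left,
        ?_⟩
      rintro y ⟨-, hy⟩ hyy
      obtain rfl := hy hyy
      rfl
  exact ⟨s, s.contMDiff, fun x hx => by rw [hs x hx]; exact ha₀ x⟩

theorem exists_nhds_disjoint_image (hιc : Continuous ι) {x : J} (hx : ι x ≠ x) :
    ∃ N ∈ 𝓝 x, ∀ y ∈ N, ι y ∉ N := by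
  obtain ⟨U, V, hU, hV, hxU, hxV, hUV⟩ := t2_separation hx
  refine ⟨V ∩ ι ⁻¹' U, inter_mem (hV.mem_nhds hxV) (hιc.continuousAt.preimage_mem_nhds
    (hU.mem_nhds hxU)), fun y hy hy' => ?_⟩
  exact hUV.le_bot ⟨hy.2, hy'.1⟩

/-- A sequence of sections, each obtained from the previous one by a change on a member of a locally
finite family, converges to a section that is independent where the sequence is. -/
theorem exists_section_of_steps {S K : ℕ → Set J} (hS : LocallyFinite S)
    (hK : ∀ m, IsClosed (K m)) {A : Set J} (hA : IsClosed A)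
    {s₀ : ∀ x, E.Fiber x}
    (hs₀ : ContMDiff I (I.prod 𝓘(ℝ, F)) n (fun x => TotalSpace.mk' F x (s₀ x)))
    (hs₀A : ∀ x ∈ A, IsIndependentAt hι s₀ x)
    (hstep : ∀ m (s : ∀ x, E.Fiber x) (A : Set J),
      ContMDiff I (I.prod 𝓘(ℝ, F)) n (fun x => TotalSpace.mk' F x (s x)) → IsClosed A →
      (∀ x ∈ A, IsIndependentAt hι s x) → ∃ s' : ∀ x, E.Fiber x,
        ContMDiff I (I.prod 𝓘(ℝ, F)) n (fun x => TotalSpace.mk' F x (s' x)) ∧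
        (∀ x ∉ S m, s' x = s x) ∧ ∀ x ∈ A ∪ K m, IsIndependentAt hι s' x) :
    ∃ s : ∀ x, E.Fiber x, ContMDiff I (I.prod 𝓘(ℝ, F)) n (fun x => TotalSpace.mk' F x (s x)) ∧
      ∀ x ∈ A ∪ ⋃ m, K m, IsIndependentAt hι s x := by
  -- The state of the recursion: a section together with a closed set on which it is known to be
  -- independent.
  let T := {z : (∀ x, E.Fiber x) × Set J //
    ContMDiff I (I.prod 𝓘(ℝ, F)) n (fun x => TotalSpace.mk' F x (z.1 x)) ∧ IsClosed z.2 ∧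
      ∀ x ∈ z.2, IsIndependentAt hι z.1 x}
  have hnext (m : ℕ) (z : T) : ∃ z' : T, (∀ x ∉ S m, z'.1.1 x = z.1.1 x) ∧
      z'.1.2 = z.1.2 ∪ K m := by
    obtain ⟨⟨s, A⟩, h₁, h₂, h₃⟩ := z
    obtain ⟨s', h₁', h₂', h₃'⟩ := hstep m s A h₁ h₂ h₃
    exact ⟨⟨⟨s', A ∪ K m⟩, h₁', h₂.union (hK m), h₃'⟩, h₂', rfl⟩
  choose next hnext_eq hnext_set using hnext
  let σ : ℕ → T := fun m => Nat.rec ⟨⟨s₀, A⟩, hs₀, hA, hs₀A⟩ next m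
  have hσ (m : ℕ) : σ (m + 1) = next m (σ m) := rfl
  have hmono : Monotone fun m => (σ m).1.2 := monotone_nat_of_le_succ fun m => by
    rw [hσ, hnext_set]
    exact subset_union_left
  have hfin : LocallyFinite fun m => {x | (σ (m + 1)).1.1 x ≠ (σ m).1.1 x} := by
    refine hS.subset fun m x hx => ?_
    by_contra h
    exact hx (hnext_eq m (σ m) x h)
  obtain ⟨s, hs⟩ := LocallyFinite.exists_forall_eventually_eq_prod (f := fun m => (σ m).1.1) hfin
  refine ⟨s, fun x => ?_, fun x hx => ?_⟩
  · obtain ⟨m, hm⟩ := (hs x).curry.exists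
    refine ((σ m).2.1 x).congr_of_eventuallyEq ?_
    filter_upwards [hm] with y hy
    rw [hy]
  · obtain ⟨m, hm⟩ : ∃ m, x ∈ (σ m).1.2 := by
      rcases hx with hx | hx
      · exact ⟨0, hx⟩
      · obtain ⟨m, hm⟩ := mem_iUnion.1 hx
        refine ⟨m + 1, ?_⟩
        rw [hσ, hnext_set]
        exact Or.inr hm
    -- Independence at `x` involves `s` at both `x` and `ι x`, so a stage is taken at which the
    -- sequence has stabilized at both points.
    obtain ⟨j, ⟨hj₁, hj₂⟩, hj₃⟩ := (((hs x).curry.and (hs (ι x)).curry).and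
      (eventually_ge_atTop m)).exists
    have h := (σ j).2.2.2 x (hmono hj₃ hm)
    rw [IsIndependentAt, liftSection] at h ⊢
    rwa [hj₁.self_of_nhds, hj₂.self_of_nhds] at h

theorem exists_section_isIndependentAt (hιs : ContMDiff I I n ι)
    (hfix : DiscreteTopology (fixedPoints ι))
    (hdim : Module.finrank ℝ EB + 2 < Module.finrank ℝ F) :
    ∃ s : ∀ x, E.Fiber x, ContMDiff I (I.prod 𝓘(ℝ, F)) n (fun x => TotalSpace.mk' F x (s x)) ∧
      ∀ x, IsIndependentAt hι s x := by
  have : Nontrivial F := Module.nontrivial_of_finrank_pos (R := ℝ) (by omega)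
  have : LocallyCompactSpace HB := I.locallyCompactSpace
  have : LocallyCompactSpace J := ChartedSpace.locallyCompactSpace HB J
  have hιc := hιs.continuous
  obtain ⟨s₀, hs₀, hs₀fix⟩ := exists_section_ne_zero_of_fixed (E := E) hιc hfix
  -- The closure of `V` is the initial closed set; only `Vᶜ`, where `ι` acts freely, remains to be
  -- treated.
  obtain ⟨V, hV, hfixV, hVs⟩ := normal_exists_closure_subset
    (isClosed_eq hιc continuous_id : IsClosed {x | ι x = x})
    (isOpen_setOf_isIndependentAt hι hιs hs₀)
    fun x hx => isIndependentAt_of_fixed hx (hs₀fix x hx)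
  have hN (x : J) : ∃ N : Set J, ι x ≠ x → N ∈ 𝓝 x ∧ ∀ y ∈ N, ι y ∉ N := by
    by_cases hx : ι x = x
    · exact ⟨∅, fun h => absurd hx h⟩
    · obtain ⟨N, hN⟩ := exists_nhds_disjoint_image hιc hx
      exact ⟨N, fun _ => hN⟩
  choose N hN using hN
  have hVc (x : J) (hx : x ∈ Vᶜ) : ι x ≠ x := fun h => hx (hfixV h)
  obtain ⟨κ, f, hf⟩ := SmoothBumpCovering.exists_isSubordinate I hV.isClosed_compl
    (U := fun x => (trivializationAt F E.Fiber x).baseSet ∩ N x) fun x hx =>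
      inter_mem ((trivializationAt F E.Fiber x).open_baseSet.mem_nhds
        (mem_baseSet_trivializationAt F E.Fiber x)) (hN x (hVc x hx)).1
  have : Countable κ := countable_univ_iff.1
    (f.locallyFinite.countable_univ fun i => (f i).nonempty_support)
  let _ : Encodable κ := Encodable.ofCountable κ
  -- Steps are numbered by codes of bump functions. Numbers that are not codes give empty sets and a
  -- step that changes nothing.
  let S : ℕ → Set J := fun m => {x | ∃ i, Encodable.encode i = m ∧ (f i x ≠ 0 ∨ f i (ι x) ≠ 0)}
  let K : ℕ → Set J := fun m => {x | ∃ i, Encodable.encode i = m ∧ f i x = 1}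
  have hKi (i : κ) : K (Encodable.encode i) = {x | f i x = 1} := by
    ext x
    refine ⟨?_, fun hx => ⟨i, rfl, hx⟩⟩
    rintro ⟨j, hj, hx⟩
    rwa [Encodable.encode_injective hj] at hx
  have hKempty (m : ℕ) (hm : ¬∃ i : κ, Encodable.encode i = m) : K m = ∅ :=
    eq_empty_of_forall_notMem fun x ⟨i, hi, _⟩ => hm ⟨i, hi⟩
  have hS : LocallyFinite S := by
    intro x
    obtain ⟨t₁, ht₁, hfin₁⟩ := f.locallyFinite x
    obtain ⟨t₂, ht₂, hfin₂⟩ := f.locallyFinite (ι x)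
    refine ⟨t₁ ∩ ι ⁻¹' t₂, inter_mem ht₁ (hιc.continuousAt.preimage_mem_nhds ht₂),
      ((hfin₁.union hfin₂).image Encodable.encode).subset ?_⟩
    rintro m ⟨y, ⟨i, rfl, hi⟩, hy₁, hy₂⟩
    refine ⟨i, ?_, rfl⟩
    rcases hi with hi | hi
    · exact Or.inl ⟨y, hi, hy₁⟩
    · exact Or.inr ⟨ι y, hi, hy₂⟩
  have hK (m : ℕ) : IsClosed (K m) := by
    by_cases hm : ∃ i : κ, Encodable.encode i = m
    · obtain ⟨i, rfl⟩ := hm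
      rw [hKi]
      exact isClosed_eq (f i).continuous continuous_const
    · rw [hKempty m hm]
      exact isClosed_empty
  obtain ⟨s, hs, hsind⟩ := exists_section_of_steps hι hS hK (isClosed_closure (s := V)) hs₀
    (fun x hx => hVs hx) fun m s A hs hA hsA => by
      by_cases hm : ∃ i : κ, Encodable.encode i = m
      · obtain ⟨i, rfl⟩ := hm
        have hNi := (hN (f.c i) (hVc _ (f.c_mem' i))).2
        obtain ⟨s', h₁, h₂, h₃, h₄⟩ := exists_perturbation hι hιs hdim hs hA hsA (f i)
          ((hf i).trans inter_subset_left) fun x hx hx' => hNi x (hf i hx).2 (hf i hx').2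
        refine ⟨s', h₁, fun x hx => ?_, ?_⟩
        · refine h₂ x ?_ ?_ <;> by_contra h
          · exact hx ⟨i, rfl, Or.inl h⟩
          · exact hx ⟨i, rfl, Or.inr h⟩
        · rintro x (hx | hx)
          · exact h₃ x hx
          · rw [hKi] at hx
            exact h₄ x hx
      · rw [hKempty m hm, union_empty]
        exact ⟨s, hs, fun _ _ => rfl, hsA⟩
  refine ⟨s, hs, fun x => hsind x ?_⟩
  by_cases hx : x ∈ V
  · exact Or.inl (subset_closure hx)
  · exact Or.inr (mem_iUnion.2 ⟨_, f.ind x hx, rfl, f.apply_ind x hx⟩)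

end QuaternionicBundle

theorem theorem2p5 {k l : ℕ} {J : Type u} [TopologicalSpace J] [T2Space J]
    [SecondCountableTopology J] [ChartedSpace (EuclideanSpace ℝ (Fin k)) J]
    [IsManifold (𝓡 k) ∞ J]
    (ι : J → J) (hι : ContMDiff (𝓡 k) (𝓡 k) ∞ ι) (hι_inv : Function.Involutive ι)
    (hι_fix : DiscreteTopology (Function.fixedPoints ι))
    (n : ℕ∞) {F : Type w} [NormedAddCommGroup F] [NormedSpace ℂ F]
    (hF : Module.finrank ℂ F = 2 * l)
    (E : QuaternionicBundle.{u, v} (𝓡 k) n ι F) (hkl : k + 3 ≤ 4 * l) :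
    ∃ E' : QuaternionicBundle.{u, v} (𝓡 k) n ι (EuclideanSpace ℂ (Fin (2 * (l - 1)))),
      Nonempty (E.Iso ((QuaternionicBundle.trivialLine (𝓡 k) n ι
        (hι.of_le (mod_cast le_top)) hι_inv).directSum E')) := by
  have : FiniteDimensional ℂ F := FiniteDimensional.of_finrank_pos (by omega)
  have : LocallyCompactSpace J := ChartedSpace.locallyCompactSpace (EuclideanSpace ℝ (Fin k)) J
  have hιn : ContMDiff (𝓡 k) (𝓡 k) n ι := hι.of_le (mod_cast le_top)
  -- The model fiber has real dimension `4l`, so general position requires `k + 2 < 4l`.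
  obtain ⟨s, hs, hind⟩ := QuaternionicBundle.exists_section_isIndependentAt (E := E) hι_inv hιn
    hι_fix (by rw [finrank_euclideanSpace_fin, finrank_real_of_complex, hF]; omega)
  -- The bound forces `l ≥ 1`, so the truncated `2 * (l - 1)` is the true rank `2l - 2`.
  exact QuaternionicBundle.exists_iso_directSum_of_section hι_inv _
    (by rw [finrank_euclideanSpace_fin, hF]; omega) hιn hs hind
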